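/- Consider the Five-to-One MIMO Gaussian interference channel with $M=2$ antennas at each of the five transmitters and $N=5$ antennas at each of the five receivers: receiver $1$ hears all transmitters and receiver $k\in\{2,\dots,5\}$ hears only transmitter $k$, i.e. over channel uses $t=1,\dots,n$ $$\bar Y^{[1]}(t)=\sum_{i=1}^{5}H^{[1i]}X^{[i]}(t)+Z^{[1]}(t),\qquad \bar Y^{[k]}(t)=H^{[kk]}X^{[k]}(t)+Z^{[k]}(t)\quad(k=2,\dots,5),$$ where the noise entries are i.i.d. circularly symmetric complex Gaussian with mean $0$ and variance $1$, each $X^{[i]}(t)\in\mathbb{C}^2$ is a function of the independent, uniformly distributed message of user $i$ alone, with average power $\frac1n\sum_{t=1}^n\mathbb{E}\|X^{[i]}(t)\|^2\le\rho$, and receiver $j$ decodes the message of transmitter $j$. The complex channel matrices $H^{[ji]}\in\mathbb{C}^{5\times2}$ are constant in time and known everywhere, and their entries are drawn independently from continuous (atomless) distributions. Let $R(\rho)$ be the symmetric capacity, i.e. the supremum of the rates $R$ that all five users can simultaneously achieve with error probabilities tending to zero as $n\to\infty$, and let $d=\lim_{\rho\to\infty}R(\rho)/\log\rho$ be the symmetric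 degrees of freedom (DoF) per user. Then, for almost every channel realization, $$\limsup_{\rho\to\infty}\frac{R(\rho)}{\log\rho}\le\frac{10}{7}=\frac{MN}{M+N},$$ so that $d\le 10/7$ whenever the limit $d$ exists; that is, the DoF per user is bounded above by the value $MN/(M+N)$ of the decomposition bound. -/

import Mathlib

open MeasureTheory ProbabilityTheory Filter Topology
open scoped ENNReal NNReal Matrix

noncomputable section

namespace MIMO

/-- Channel coefficients of a `K`-user MIMO interference channel with `M` antennas at each
transmitter and `N` at each receiver: `H j i` is the `N × M` matrix from transmitter `i` to
receiver `j`. The channel is constant over time. -/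
abbrev Channel (K M N : ℕ) : Type := Fin K → Fin K → Matrix (Fin N) (Fin M) ℂ

/-- The many-to-one topology: receiver `0` hears every transmitter, while every other receiver
hears only its own transmitter. The coefficients on the absent links are discarded. -/
def manyToOne {K M N : ℕ} [NeZero K] (H : Channel K M N) : Channel K M N :=
  fun j i => if j = 0 ∨ i = j then H j i else 0

/-- The circularly symmetric complex Gaussian law with mean zero and variance one: independent
real and imaginary parts, each of variance `1/2`. -/
def complexGaussian : Measure ℂ :=
  ((gaussianReal 0 (1 / 2)).prod (gaussianReal 0 (1 / 2))).map
    Complex.measurableEquivRealProd.symm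

instance : IsProbabilityMeasure complexGaussian :=
  Measure.isProbabilityMeasure_map Complex.measurableEquivRealProd.symm.measurable.aemeasurable

/-- The law of the noise at one receiver over `n` channel uses: i.i.d. over time and antennas. -/
def noise (N n : ℕ) : Measure (Fin n → Fin N → ℂ) :=
  Measure.pi fun _ => Measure.pi fun _ => complexGaussian

instance (N n : ℕ) : IsProbabilityMeasure (noise N n) := by
  unfold noise; infer_instance

/-- A block code of length `n` with `m` messages per user: one encoder per transmitter, acting on
that transmitter's message only, and one measurable decoder per receiver, acting on the block
received there. -/
structure Code (K M N n m : ℕ) where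
  enc : Fin K → Fin m → Fin n → Fin M → ℂ
  dec : Fin K → (Fin n → Fin N → ℂ) → Fin m
  measurable_dec : ∀ j, Measurable (dec j)

namespace Code

variable {K M N n m : ℕ}

/-- The average power `(1/n) ∑ₜ E ‖X i t‖²` of transmitter `i`, the expectation being over a
uniformly distributed message. -/
def power (c : Code K M N n m) (i : Fin K) : ℝ :=
  (∑ w : Fin m, ∑ t : Fin n, ∑ a : Fin M, ‖c.enc i w t a‖ ^ 2) / (m * n)

/-- The noise-free block at receiver `j` when the messages `w` are sent. -/
def signal (c : Code K M N n m) (H : Channel K M N) (w : Fin K → Fin m) (j : Fin K) :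
    Fin n → Fin N → ℂ :=
  fun t => ∑ i : Fin K, H j i *ᵥ c.enc i (w i) t

/-- The probability that receiver `j` decodes its message wrongly, when the messages of the users
are independent and uniform, and independent of the noise. -/
def errorProb (c : Code K M N n m) (H : Channel K M N) (j : Fin K) : ℝ :=
  (∑ w : Fin K → Fin m, (noise N n).real {z | c.dec j (c.signal H w j + z) ≠ w j}) / (m : ℝ) ^ K

end Code

/-- The rate `R` (in nats per channel use) is simultaneously achievable by all users under the
power constraint `ρ`: there are codes of every large block length `n`, with `⌈exp (n R)⌉` messages
per user, whose error probabilities tend to zero. The codes may depend on the channel. -/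
def IsAchievable {K M N : ℕ} (H : Channel K M N) (ρ : ℝ) (R : ℝ≥0) : Prop :=
  ∀ ε : ℝ, 0 < ε → ∀ᶠ n : ℕ in atTop,
    ∃ c : Code K M N n ⌈Real.exp (n * R)⌉₊,
      (∀ i, c.power i ≤ ρ) ∧ ∀ j, c.errorProb H j ≤ ε

/-- The symmetric capacity, the highest rate simultaneously achievable by every user. -/
def symmetricCapacity {K M N : ℕ} (H : Channel K M N) (ρ : ℝ) : ℝ≥0∞ :=
  ⨆ (R : ℝ≥0) (_ : IsAchievable H ρ R), (R : ℝ≥0∞)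

/-- `d` is the symmetric DoF per user of `H`: the limit of capacity over `log ρ` as `ρ → ∞`. -/
def HasDoF {K M N : ℕ} (H : Channel K M N) (d : ℝ≥0∞) : Prop :=
  Tendsto (fun ρ : ℝ => symmetricCapacity H ρ / ENNReal.ofReal (Real.log ρ)) atTop (𝓝 d)

/-- The upper symmetric DoF per user, defined even where the limit is not known to exist. -/
def upperDoF {K M N : ℕ} (H : Channel K M N) : ℝ≥0∞ :=
  limsup (fun ρ : ℝ => symmetricCapacity H ρ / ENNReal.ofReal (Real.log ρ)) atTop

/-- The value `M N / (M + N)` of the decomposition bound. -/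
def decompositionBound (M N : ℕ) : ℝ≥0∞ := (M * N : ℝ≥0∞) / (M + N)

end MIMO

end

/-! Number the users 0 to 4 and let T be the quantized noise-free block at receiver 0. It has five
complex coordinates per channel use, so the power constraint gives H(T) ≤ 5 n log ρ + O(n).

A generic row V annihilates the four columns of users 2 and 3 at receiver 0. From T one decodes
message 0. With message 4 given as side information, V then exposes one scalar functional q of the
input of user 1. With message 1 given as well, users 2 and 3 occupy four of the five dimensions and
can be inverted, hence decoded. The chain rule yields H(T) ≥ 3 log m + H(q), up to terms of order n
and an error-probability multiple of log m. Exchanging users 3 and 4 gives the same bound with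
another functional q'. Generically q and q' together determine the input of user 1, so H(q) + H(q')
≥ H(q, q') ≥ log m up to the same kind of loss. Adding the two bounds gives 7 log m ≤ 10 n log ρ +
O(n), that is, 10/7 per user (`ZeroForcing.seven_log_le`).

All entropies are discrete, for uniform messages and signals rounded to integers; no differential
entropy occurs. Noise enters only through `condEntropy_message_le`, a form of Fano's inequality: a
label that fixes a receiver's signal up to a bounded error leaves its message little entropy,
because boundedly shifted Gaussian noise is dominated by a constant per coordinate times one wider
Gaussian. That loss is independent of ρ and disappears after division by log ρ.

Genericity is the nonvanishing of one polynomial, `zeroForcingDet`, in the independent atomless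
entries. -/

noncomputable section

namespace MIMO

/-! ### Discrete entropy under the uniform distribution. -/

section Entropy

open Classical in
/-- The number of points on which `f` takes the same value as at `x`. -/
def fiberCard {Ω α : Type*} [Fintype Ω] (f : Ω → α) (x : Ω) : ℕ :=
  (Finset.univ.filter fun y => f y = f x).card

/-- The Shannon entropy (in nats) of `f x` for `x` uniformly distributed on `Ω`. -/
def entropy {Ω α : Type*} [Fintype Ω] (f : Ω → α) : ℝ :=
  (∑ x, (Real.log (Fintype.card Ω) - Real.log (fiberCard f x))) / Fintype.card Ω

/-- The conditional entropy of `f` given `g` under the uniform distribution. -/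
def condEntropy {Ω α β : Type*} [Fintype Ω] (f : Ω → α) (g : Ω → β) : ℝ :=
  entropy (fun x => (f x, g x)) - entropy g

variable {Ω α β γ : Type*} [Fintype Ω]

lemma fiberCard_pos (f : Ω → α) (x : Ω) : 0 < fiberCard f x :=
  Finset.card_pos.2 ⟨x, by simp⟩

lemma fiberCard_le_of_imp {f : Ω → α} {g : Ω → β} (h : ∀ x y, f x = f y → g x = g y) (x : Ω) :
    fiberCard f x ≤ fiberCard g x := by
  classical
  refine Finset.card_le_card fun y hy => ?_
  simp only [Finset.mem_filter, Finset.mem_univ, true_and] at hy ⊢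
  exact h _ _ hy

lemma entropy_le_of_imp {f : Ω → α} {g : Ω → β} (h : ∀ x y, f x = f y → g x = g y) :
    entropy g ≤ entropy f := by
  unfold entropy
  gcongr with x
  · exact_mod_cast fiberCard_pos f x
  · exact fiberCard_le_of_imp h x

lemma entropy_congr {f : Ω → α} {g : Ω → β} (h : ∀ x y, f x = f y ↔ g x = g y) :
    entropy f = entropy g :=
  le_antisymm (entropy_le_of_imp fun x y => (h x y).2) (entropy_le_of_imp fun x y => (h x y).1)

lemma entropy_of_injective {f : Ω → α} (hf : Function.Injective f) :
    entropy f = Real.log (Fintype.card Ω) := by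
  have h1 (x) : fiberCard f x = 1 := by
    unfold fiberCard
    rw [Finset.card_eq_one]
    exact ⟨x, by ext y; simp [hf.eq_iff]⟩
  unfold entropy
  rcases isEmpty_or_nonempty Ω with h | h
  · simp
  · simp [h1]

lemma entropy_const (a : α) : entropy (fun _ : Ω => a) = 0 := by
  simp [entropy, fiberCard]

lemma condEntropy_eq_sum (f : Ω → α) (g : Ω → β) :
    condEntropy f g = (∑ x, (Real.log (fiberCard g x) -
      Real.log (fiberCard (fun x => (f x, g x)) x))) / Fintype.card Ω := by
  unfold condEntropy entropy
  rw [← sub_div, ← Finset.sum_sub_distrib]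
  congr 1
  exact Finset.sum_congr rfl fun x _ => by ring

open Classical in
/-- **Gibbs' inequality** for the conditional law of `f` given `g`. -/
lemma condEntropy_le_of_kernel (f : Ω → α) (g : Ω → β) (K : α → β → ℝ)
    (hK : ∀ a b, 0 ≤ K a b) (hpos : ∀ x, 0 < K (f x) (g x))
    (hsum : ∀ x, ∑ a ∈ Finset.univ.image f, K a (g x) ≤ 1) :
    condEntropy f g ≤ (∑ x, -Real.log (K (f x) (g x))) / Fintype.card Ω := by
  rw [condEntropy_eq_sum]
  refine div_le_div_of_nonneg_right ?_ (Nat.cast_nonneg _)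
  set p : Ω → ℕ := fiberCard (fun x => (f x, g x)) with hp
  have hppos : ∀ x, (0 : ℝ) < p x := fun x => by exact_mod_cast fiberCard_pos _ x
  have hgpos : ∀ x, (0 : ℝ) < fiberCard g x := fun x => by exact_mod_cast fiberCard_pos _ x
  -- A joint fibre of `(f, g)` has `p x` points, each weighted by `1 / p x`, so it contributes `K`
  -- once. Each inner sum is thus a sum of `K` over distinct values of `f`, at most 1.
  have key : ∑ x, (fiberCard g x : ℝ) * K (f x) (g x) / p x ≤ Fintype.card Ω := by
    have e1 : ∑ x, (fiberCard g x : ℝ) * K (f x) (g x) / p x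
        = ∑ y, ∑ x ∈ Finset.univ.filter (fun x => g x = g y), K (f x) (g y) / p x := by
      have : ∀ x, (fiberCard g x : ℝ) * K (f x) (g x) / p x
          = ∑ y, if g x = g y then K (f x) (g y) / p x else 0 := fun x => by
        rw [← Finset.sum_filter]
        rw [Finset.sum_congr rfl (g := fun _ => K (f x) (g x) / p x)]
        · rw [Finset.sum_const, nsmul_eq_mul, mul_div_assoc]
          congr 2
          unfold fiberCard
          congr 1; ext y; simp [eq_comm]
        · intro y hy
          simp only [Finset.mem_filter, Finset.mem_univ, true_and] at hy
          rw [hy]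
      simp_rw [this]
      rw [Finset.sum_comm]
      simp_rw [Finset.sum_filter]
    rw [e1]
    have : ∀ y, ∑ x ∈ Finset.univ.filter (fun x => g x = g y), K (f x) (g y) / p x ≤ 1 := fun y => by
      refine le_trans ?_ (hsum y)
      rw [← Finset.sum_fiberwise_of_maps_to (t := Finset.univ.image f) (g := f)
        (fun x _ => Finset.mem_image_of_mem f (Finset.mem_univ x))]
      refine Finset.sum_le_sum fun a _ => ?_
      rcases (Finset.filter (fun x => f x = a)
        (Finset.univ.filter (fun x => g x = g y))).eq_empty_or_nonempty with he | ⟨x₀, hx₀⟩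
      · rw [he]; simpa using hK a (g y)
      · simp only [Finset.mem_filter, Finset.mem_univ, true_and] at hx₀
        have hc : ∀ x ∈ Finset.filter (fun x => f x = a)
            (Finset.univ.filter (fun x => g x = g y)), K (f x) (g y) / p x = K a (g y) / p x₀ := by
          intro x hx
          simp only [Finset.mem_filter, Finset.mem_univ, true_and] at hx
          have : p x = p x₀ := by simp only [hp, fiberCard, hx.1, hx.2, hx₀.1, hx₀.2]
          rw [this, hx.2]
        rw [Finset.sum_congr rfl hc, Finset.sum_const, nsmul_eq_mul]
        have : (Finset.filter (fun x => f x = a)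
            (Finset.univ.filter (fun x => g x = g y))).card = p x₀ := by
          simp only [hp, fiberCard, hx₀.1, hx₀.2, Finset.filter_filter, Prod.mk.injEq]
          congr 1; ext x; simp [and_comm]
        rw [this, mul_div_cancel₀ _ (hppos x₀).ne']
    calc _ ≤ ∑ y : Ω, (1 : ℝ) := Finset.sum_le_sum fun y _ => this y
      _ = _ := by simp
  have hlog : ∀ x, Real.log (fiberCard g x) - Real.log (p x)
      ≤ -Real.log (K (f x) (g x)) + ((fiberCard g x : ℝ) * K (f x) (g x) / p x - 1) := fun x => by
    have := Real.log_le_sub_one_of_pos (div_pos (mul_pos (hgpos x) (hpos x)) (hppos x))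
    rw [Real.log_div (mul_pos (hgpos x) (hpos x)).ne' (hppos x).ne',
      Real.log_mul (hgpos x).ne' (hpos x).ne'] at this
    linarith
  calc _ ≤ _ := Finset.sum_le_sum fun x _ => hlog x
    _ ≤ _ := by
      rw [Finset.sum_add_distrib, Finset.sum_sub_distrib]
      simp only [Finset.sum_const, Finset.card_univ, nsmul_eq_mul, mul_one]
      linarith

/-- Conditioning reduces entropy. -/
lemma condEntropy_pair_le (f : Ω → α) (g : Ω → β) (h : Ω → γ) :
    condEntropy f (fun x => (g x, h x)) ≤ condEntropy f g := by
  classical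
  have hN : ∀ (s : Finset Ω), (0 : ℝ) ≤ s.card := fun s => Nat.cast_nonneg _
  -- The conditional law of `f` given `g` alone, ignoring `h`; its Gibbs bound is exactly
  -- `condEntropy f g`.
  let K : α → β × γ → ℝ := fun a b =>
    ((Finset.univ.filter fun y => f y = a ∧ g y = b.1).card : ℝ) /
      (Finset.univ.filter fun y => g y = b.1).card
  have hval : ∀ x, K (f x) (g x, h x) =
      (fiberCard (fun x => (f x, g x)) x : ℝ) / fiberCard g x := fun x => by
    simp [K, fiberCard]
  have hp : ∀ x, (0 : ℝ) < fiberCard (fun x => (f x, g x)) x :=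
    fun x => by exact_mod_cast fiberCard_pos _ x
  have hg : ∀ x, (0 : ℝ) < fiberCard g x := fun x => by exact_mod_cast fiberCard_pos _ x
  refine (condEntropy_le_of_kernel f (fun x => (g x, h x)) K
    (fun a b => div_nonneg (hN _) (hN _)) (fun x => ?_) (fun x => ?_)).trans ?_
  · rw [hval]; exact div_pos (hp x) (hg x)
  · simp only [K]
    rw [← Finset.sum_div, ← Nat.cast_sum, div_le_one (by exact hg x), Nat.cast_le]
    rw [Finset.card_eq_sum_card_fiberwise (f := f) (t := Finset.univ.image f)
      (fun x _ => by simp)]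
    refine le_of_eq (Finset.sum_congr rfl fun a _ => ?_)
    congr 1; ext y; simp [and_comm]
  · rw [condEntropy_eq_sum]
    refine le_of_eq ?_
    congr 1
    refine Finset.sum_congr rfl fun x _ => ?_
    rw [hval, Real.log_div (hp x).ne' (hg x).ne']
    ring

lemma condEntropy_mono {f : Ω → α} {g : Ω → β} {h : Ω → γ} (H : ∀ x y, h x = h y → g x = g y) :
    condEntropy f h ≤ condEntropy f g := by
  refine le_trans (le_of_eq ?_) (condEntropy_pair_le f g h)
  unfold condEntropy
  congr 1
  · refine entropy_congr fun x y => ?_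
    have := H x y
    simp only [Prod.mk.injEq]
    tauto
  · refine entropy_congr fun x y => ?_
    have := H x y
    simp only [Prod.mk.injEq]
    tauto

lemma entropy_eq_condEntropy (f : Ω → α) : entropy f = condEntropy f (fun _ => ()) := by
  unfold condEntropy
  rw [entropy_const, sub_zero]
  exact entropy_congr fun x y => by simp

lemma condEntropy_le_entropy (f : Ω → α) (g : Ω → β) : condEntropy f g ≤ entropy f := by
  rw [entropy_eq_condEntropy]
  exact condEntropy_mono fun _ _ _ => rfl

open Classical in
/-- If `f` takes at most `L` values once `g` is known, its conditional entropy is at most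
`log L`. -/
lemma condEntropy_le_log_of_mem [Nonempty Ω] (f : Ω → α) (g : Ω → β) (S : β → Finset α) (L : ℝ) (hL : 0 < L)
    (hS : ∀ x, f x ∈ S (g x)) (hcard : ∀ b, ((S b).card : ℝ) ≤ L) :
    condEntropy f g ≤ Real.log L := by
  refine (condEntropy_le_of_kernel f g (fun a b => if a ∈ S b then L⁻¹ else 0)
    (fun a b => by split_ifs <;> positivity) (fun x => by simp [hS, hL]) (fun x => ?_)).trans ?_
  · rw [← Finset.sum_filter, Finset.sum_const, nsmul_eq_mul, ← div_eq_mul_inv, div_le_one hL]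
    refine le_trans ?_ (hcard (g x))
    exact_mod_cast Finset.card_le_card fun a ha => (Finset.mem_filter.1 ha).2
  · simp only [hS, if_true, Real.log_inv, neg_neg, Finset.sum_const, Finset.card_univ, nsmul_eq_mul]
    have : (Fintype.card Ω : ℝ) ≠ 0 := by exact_mod_cast Fintype.card_ne_zero
    rw [mul_div_cancel_left₀ _ this]

end Entropy

/-! ### Domination of shifted Gaussian noise. -/

section Gaussian

/-- `OuterMeasure.pi` is the largest outer measure bounded on boxes by the product, so the
comparison need only be made on boxes. -/
lemma pi_measure_mono {ι : Type*} [Fintype ι] {α : ι → Type*} [∀ i, MeasurableSpace (α i)]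
    {μ ν : ∀ i, Measure (α i)} [∀ i, SigmaFinite (μ i)] [∀ i, SigmaFinite (ν i)]
    (h : ∀ i, μ i ≤ ν i) : Measure.pi μ ≤ Measure.pi ν := by
  refine Measure.le_iff.2 fun s hs => ?_
  have h1 : (Measure.pi μ).toOuterMeasure ≤ OuterMeasure.pi fun i => (ν i).toOuterMeasure := by
    refine OuterMeasure.le_pi.2 fun t _ => ?_
    have : (Measure.pi μ).toOuterMeasure (Set.univ.pi t) = ∏ i, μ i (t i) := Measure.pi_pi μ t
    rw [this]
    exact Finset.prod_le_prod' fun i _ => h i (t i)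
  have h2 : Measure.pi ν s = OuterMeasure.pi (fun i => (ν i).toOuterMeasure) s := by
    rw [Measure.pi, toMeasure_apply _ _ hs]
  rw [h2]
  exact h1 s

lemma pi_measure_smul {ι : Type*} [Fintype ι] {α : ι → Type*} [∀ i, MeasurableSpace (α i)]
    (ν : ∀ i, Measure (α i)) [∀ i, IsFiniteMeasure (ν i)] (c : ℝ≥0) :
    Measure.pi (fun i => c • ν i) = c ^ Fintype.card ι • Measure.pi ν := by
  refine Measure.pi_eq fun s _ => ?_
  rw [Measure.coe_nnreal_smul_apply, Measure.pi_pi]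
  simp_rw [Measure.coe_nnreal_smul_apply]
  rw [Finset.prod_mul_distrib, Finset.prod_const, Finset.card_univ, ENNReal.coe_pow]

/-- A shifted Gaussian is dominated by a wider centred one. -/
lemma gaussianReal_shift_le (D : ℝ) : ∃ C : ℝ≥0, 1 ≤ C ∧ ∀ x : ℝ, |x| ≤ D →
    (gaussianReal 0 (1 / 2)).map (x + ·) ≤ C • gaussianReal 0 1 := by
  -- The factor 2 covers the ratio √2 of the normalizations. The exponents compare because (y - x)²
  -- + x² - y²/2 = (y - 2x)²/2 ≥ 0; the larger variance absorbs the cross term.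
  refine ⟨Real.toNNReal (2 * Real.exp (D ^ 2)), ?_, fun x hx => ?_⟩
  · have := Real.one_le_exp (sq_nonneg D)
    exact Real.one_le_toNNReal.2 (by linarith)
  · rw [gaussianReal_map_const_add, gaussianReal_of_var_ne_zero _ (by norm_num),
      gaussianReal_of_var_ne_zero _ (by norm_num)]
    rw [ENNReal.smul_def, ← withDensity_smul _ (measurable_gaussianPDF 0 1)]
    refine withDensity_mono (ae_of_all _ fun y => ?_)
    simp only [Pi.smul_apply, smul_eq_mul, gaussianPDF]
    rw [← ENNReal.ofReal_coe_nnreal, ← ENNReal.ofReal_mul (NNReal.coe_nonneg _)]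
    refine ENNReal.ofReal_le_ofReal ?_
    rw [Real.coe_toNNReal _ (by positivity)]
    simp only [gaussianPDFReal, NNReal.coe_one, zero_add, sub_zero]
    have h1 : (√(2 * Real.pi * ((1 / 2 : ℝ≥0) : ℝ)))⁻¹ ≤ 2 * (√(2 * Real.pi * 1))⁻¹ := by
      have : √(2 * Real.pi * 1) ≤ 2 * √(2 * Real.pi * ((1 / 2 : ℝ≥0) : ℝ)) := by
        rw [show (2 : ℝ) * √(2 * Real.pi * ((1 / 2 : ℝ≥0) : ℝ))
          = √(2 ^ 2 * (2 * Real.pi * ((1 / 2 : ℝ≥0) : ℝ))) from by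
            rw [Real.sqrt_mul (x := 2 ^ 2) (by norm_num), Real.sqrt_sq (by norm_num)]]
        apply Real.sqrt_le_sqrt
        push_cast
        nlinarith [Real.pi_pos]
      have p1 : 0 < √(2 * Real.pi * ((1 / 2 : ℝ≥0) : ℝ)) := by
        apply Real.sqrt_pos.2; push_cast; nlinarith [Real.pi_pos]
      have p2 : 0 < √(2 * Real.pi * 1) := by
        apply Real.sqrt_pos.2; nlinarith [Real.pi_pos]
      rw [← div_eq_mul_inv, le_div_iff₀ p2, inv_mul_le_iff₀ p1]
      linarith
    have h2 : Real.exp (-(y - x) ^ 2 / (2 * ((1 / 2 : ℝ≥0) : ℝ)))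
        ≤ Real.exp (D ^ 2) * Real.exp (-y ^ 2 / (2 * 1)) := by
      rw [← Real.exp_add]
      apply Real.exp_le_exp.2
      push_cast
      have : x ^ 2 ≤ D ^ 2 := by
        rw [← sq_abs x]; exact pow_le_pow_left₀ (abs_nonneg _) hx 2
      nlinarith [sq_nonneg (y - 2 * x)]
    calc _ ≤ (2 * (√(2 * Real.pi * 1))⁻¹) * (Real.exp (D ^ 2) * Real.exp (-y ^ 2 / (2 * 1))) :=
          mul_le_mul h1 h2 (Real.exp_pos _).le (by positivity)
      _ = _ := by ring

/-- A wide complex Gaussian law, dominating all small shifts of `complexGaussian`. -/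
def wideGaussian : Measure ℂ :=
  ((gaussianReal 0 1).prod (gaussianReal 0 1)).map Complex.measurableEquivRealProd.symm

instance : IsProbabilityMeasure wideGaussian :=
  Measure.isProbabilityMeasure_map Complex.measurableEquivRealProd.symm.measurable.aemeasurable

lemma complexGaussian_shift_le (D : ℝ) : ∃ C : ℝ≥0, 1 ≤ C ∧ ∀ x : ℂ, ‖x‖ ≤ D →
    complexGaussian.map (x + ·) ≤ C • wideGaussian := by
  obtain ⟨C, hC1, hC⟩ := gaussianReal_shift_le D
  refine ⟨C * C, one_le_mul hC1 hC1, fun x hx => ?_⟩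
  have e : complexGaussian.map (x + ·)
      = (((gaussianReal 0 (1 / 2)).map (x.re + ·)).prod
          ((gaussianReal 0 (1 / 2)).map (x.im + ·))).map Complex.measurableEquivRealProd.symm := by
    rw [Measure.map_prod_map _ _ (measurable_const_add _) (measurable_const_add _),
      complexGaussian, Measure.map_map (measurable_const_add _) (MeasurableEquiv.measurable _),
      Measure.map_map (MeasurableEquiv.measurable _)
        ((measurable_const_add _).prodMap (measurable_const_add _))]
    congr 1
  rw [e]
  calc _ ≤ ((C • gaussianReal 0 1).prod (C • gaussianReal 0 1)).map
        Complex.measurableEquivRealProd.symm := by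
        refine Measure.map_mono (Measure.prod_mono (hC _ ?_) (hC _ ?_))
          (MeasurableEquiv.measurable _)
        · exact (Complex.abs_re_le_norm x).trans hx
        · exact (Complex.abs_im_le_norm x).trans hx
    _ = _ := by
        have h (c : ℝ≥0) (μ : Measure ℝ) : c • μ = (c : ℝ≥0∞) • μ := rfl
        rw [wideGaussian, h, Measure.prod_smul_left, Measure.prod_smul_right, smul_smul,
          Measure.map_smul, ← ENNReal.coe_mul]
        rfl

/-- The block version of `wideGaussian`. -/
def wideNoise (N n : ℕ) : Measure (Fin n → Fin N → ℂ) :=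
  Measure.pi fun _ => Measure.pi fun _ => wideGaussian

instance (N n : ℕ) : IsProbabilityMeasure (wideNoise N n) := by
  unfold wideNoise; infer_instance

/-- The law is a product, so the scalar constants multiply: the logarithmic cost is `log C` per
antenna and channel use, with `C` depending only on `D`. -/
lemma noise_shift_le (D : ℝ) : ∃ C : ℝ≥0, 1 ≤ C ∧ ∀ (N n : ℕ) (x : Fin n → Fin N → ℂ),
    (∀ t b, ‖x t b‖ ≤ D) → (noise N n).map (x + ·) ≤ (C ^ N) ^ n • wideNoise N n := by
  obtain ⟨C, hC1, hC⟩ := complexGaussian_shift_le D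
  refine ⟨C, hC1, fun N n x hx => ?_⟩
  have inner (t : Fin n) : (Measure.pi fun _ : Fin N => complexGaussian).map (x t + ·)
      = Measure.pi fun b => complexGaussian.map (x t b + ·) :=
    Measure.pi_map_pi (μ := fun _ : Fin N => complexGaussian) (f := fun b => (x t b + ·))
      fun _ => (measurable_const_add _).aemeasurable
  have outer : (noise N n).map (x + ·)
      = Measure.pi fun t => (Measure.pi fun _ : Fin N => complexGaussian).map (x t + ·) := by
    have (t : Fin n) : IsProbabilityMeasure
        ((Measure.pi fun _ : Fin N => complexGaussian).map (x t + ·)) :=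
      Measure.isProbabilityMeasure_map (measurable_const_add _).aemeasurable
    exact Measure.pi_map_pi (μ := fun _ : Fin n => Measure.pi fun _ : Fin N => complexGaussian)
      (f := fun t => (x t + ·)) fun _ => (measurable_const_add _).aemeasurable
  have (t : Fin n) (b : Fin N) : IsProbabilityMeasure (complexGaussian.map (x t b + ·)) :=
    Measure.isProbabilityMeasure_map (measurable_const_add _).aemeasurable
  rw [outer]
  simp_rw [inner]
  have h1 (t : Fin n) : Measure.pi (fun b => complexGaussian.map (x t b + ·))
      ≤ C ^ N • Measure.pi fun _ : Fin N => wideGaussian := by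
    have := pi_measure_smul (fun _ : Fin N => wideGaussian) C
    rw [Fintype.card_fin] at this
    rw [← this]
    exact pi_measure_mono fun b => hC _ (hx t b)
  have h2 := pi_measure_smul (fun _ : Fin n => Measure.pi fun _ : Fin N => wideGaussian) (C ^ N)
  rw [Fintype.card_fin] at h2
  rw [wideNoise, ← h2]
  exact pi_measure_mono h1

end Gaussian

/-! ### A Fano-type inequality for labels that fix the signal up to a bounded error. -/

namespace Code

variable {K M N n m : ℕ}

/-- The probability that receiver `j` decodes correctly when the messages `w` are sent. -/
def successProb (c : Code K M N n m) (H : Channel K M N) (j : Fin K) (w : Fin K → Fin m) : ℝ :=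
  (noise N n).real {z | c.dec j (c.signal H w j + z) = w j}

lemma measurableSet_dec (c : Code K M N n m) (j : Fin K) (s : Fin n → Fin N → ℂ) (a : Fin m) :
    MeasurableSet {z | c.dec j (s + z) = a} :=
  ((c.measurable_dec j).comp (measurable_const_add s)) (measurableSet_singleton a)

open Classical in
/-- The fraction of message tuples decoded with probability less than one half is at most twice
the error probability. -/
lemma card_bad_le (c : Code K M N n m) [NeZero m] (H : Channel K M N) (j : Fin K) :
    ((Finset.univ.filter fun w => c.successProb H j w < 1 / 2).card : ℝ)
      ≤ 2 * c.errorProb H j * (m : ℝ) ^ K := by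
  have hm : (0 : ℝ) < (m : ℝ) ^ K := pow_pos (by exact_mod_cast Nat.pos_of_neZero m) K
  have h1 (w : Fin K → Fin m) : (noise N n).real {z | c.dec j (c.signal H w j + z) ≠ w j}
      = 1 - c.successProb H j w :=
    probReal_compl_eq_one_sub (c.measurableSet_dec j _ _)
  rw [errorProb, mul_assoc, div_mul_cancel₀ _ hm.ne', Finset.mul_sum, Finset.card_eq_sum_ones,
    Finset.sum_filter, Nat.cast_sum]
  refine Finset.sum_le_sum fun w _ => ?_
  rw [h1]
  have : c.successProb H j w ≤ 1 := measureReal_le_one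
  split_ifs with h
  · push_cast; linarith
  · push_cast; linarith

end Code

/-- If the label `F` pins down the signal at receiver `j` up to a bounded error, then, given `F`,
the message of user `j` has small entropy. -/
lemma condEntropy_message_le (D : ℝ) : ∃ C : ℝ, 0 ≤ C ∧ ∀ {K M N n m : ℕ} [NeZero m] {β : Type}
    (c : Code K M N n m) (H : Channel K M N) (j : Fin K) (F : (Fin K → Fin m) → β),
    (∀ w w', F w = F w' → ∀ t b, ‖c.signal H w j t b - c.signal H w' j t b‖ ≤ D) →
    condEntropy (fun w => w j) F
      ≤ Real.log 4 + n * N * C + 2 * c.errorProb H j * Real.log m := by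
  classical
  obtain ⟨C, hC1, hC⟩ := noise_shift_le D
  have hC1' : (1 : ℝ) ≤ C := by exact_mod_cast hC1
  refine ⟨Real.log C, Real.log_nonneg hC1', ?_⟩
  intro K M N n m _ β c H j F hF
  have hm : (0 : ℝ) < m := by exact_mod_cast Nat.pos_of_neZero m
  have hm1 : (1 : ℝ) ≤ m := by exact_mod_cast Nat.pos_of_neZero m
  -- The label is turned into a guess: choose one message tuple with that label, and let `Q` be the
  -- law of the decoder's output when its signal is sent through the wide noise.
  let r : β → (Fin K → Fin m) := Function.invFun F
  have hr (w) : F (r (F w)) = F w := Function.invFun_eq ⟨w, rfl⟩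
  let Q : Fin m → β → ℝ := fun a b =>
    (wideNoise N n).real {z | c.dec j (c.signal H (r b) j + z) = a}
  have hQ (a b) : 0 ≤ Q a b := measureReal_nonneg
  let L : ℝ := ((C : ℝ) ^ N) ^ n
  have hL : 1 ≤ L := one_le_pow₀ (one_le_pow₀ hC1')
  have hQsum (b) : ∑ a, Q a b = 1 := by
    have h := sum_measureReal_preimage_singleton (μ := wideNoise N n) (Finset.univ : Finset (Fin m))
      (f := fun z => c.dec j (c.signal H (r b) j + z)) (fun a _ => c.measurableSet_dec j _ a)
    simp only [Finset.coe_univ, Set.preimage_univ, probReal_univ] at h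
    exact h
  have hgood (w) : c.successProb H j w ≤ L * Q (w j) (F w) := by
    have h0 := hC N n (c.signal H w j - c.signal H (r (F w)) j)
      (fun t b => hF w _ (hr w).symm t b)
    have h1 := h0 {y | c.dec j (c.signal H (r (F w)) j + y) = w j}
    rw [Measure.map_apply (measurable_const_add _) (c.measurableSet_dec j _ _),
      Measure.coe_nnreal_smul_apply] at h1
    have h2 := ENNReal.toReal_mono (ENNReal.mul_ne_top ENNReal.coe_ne_top (measure_ne_top _ _)) h1
    rw [ENNReal.toReal_mul] at h2
    convert h2 using 1
    · unfold Code.successProb Measure.real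
      congr 2
      ext z
      simp [← add_assoc]
    · simp [L, Q, Measure.real]
  -- Mixing with the uniform law keeps the kernel at least `1 / (2m)`, so a badly decoded tuple
  -- costs at most `log (2m)`. A tuple decoded with probability at least 1/2 has `Q ≥ 1 / (2L)` and
  -- costs at most `log (4L)`.
  let Kr : Fin m → β → ℝ := fun a b => (Q a b + (m : ℝ)⁻¹) / 2
  have hKm (a b) : (2 * (m : ℝ))⁻¹ ≤ Kr a b := by
    have := hQ a b
    simp only [Kr, mul_inv]
    linarith
  have hKpos (a b) : 0 < Kr a b := lt_of_lt_of_le (by positivity) (hKm a b)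
  refine (condEntropy_le_of_kernel _ F Kr (fun a b => (hKpos a b).le) (fun x => hKpos _ _)
    (fun w => ?_)).trans ?_
  · calc _ ≤ ∑ a, Kr a (F w) :=
          Finset.sum_le_sum_of_subset_of_nonneg (Finset.subset_univ _)
            fun a _ _ => (hKpos a _).le
      _ = 1 := by
          simp only [Kr]
          rw [← Finset.sum_div, Finset.sum_add_distrib, hQsum]
          simp only [Finset.sum_const, Finset.card_univ, Fintype.card_fin, nsmul_eq_mul]
          rw [mul_inv_cancel₀ hm.ne']; norm_num
  · have hbound (w) : -Real.log (Kr (w j) (F w)) ≤ Real.log 4 + Real.log L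
        + (if c.successProb H j w < 1 / 2 then Real.log m else 0) := by
      split_ifs with h
      · have h1 := Real.log_le_log (by positivity) (hKm (w j) (F w))
        rw [Real.log_inv, Real.log_mul (by norm_num) hm.ne'] at h1
        have h2 : Real.log 2 ≤ Real.log 4 := Real.log_le_log (by norm_num) (by norm_num)
        have h3 := Real.log_nonneg hL
        linarith
      · have h0 := hgood w
        have h1 : (4 * L)⁻¹ ≤ Kr (w j) (F w) := by
          have : (0 : ℝ) < (m : ℝ)⁻¹ := by positivity
          have h5 : L⁻¹ / 2 ≤ Q (w j) (F w) := by
            rw [div_le_iff₀ (by norm_num), inv_le_iff_one_le_mul₀ (by linarith)]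
            linarith
          simp only [Kr, mul_inv]
          linarith
        have h2 := Real.log_le_log (by positivity) h1
        rw [Real.log_inv, Real.log_mul (by norm_num) (by positivity)] at h2
        linarith
    have hcard : (Fintype.card (Fin K → Fin m) : ℝ) = (m : ℝ) ^ K := by simp
    have hmK : (0 : ℝ) < (m : ℝ) ^ K := by positivity
    have hlogL : Real.log L = n * N * Real.log C := by
      simp only [L, Real.log_pow]; ring
    rw [div_le_iff₀ (by rw [hcard]; exact hmK)]
    calc _ ≤ _ := Finset.sum_le_sum fun w _ => hbound w
      _ = (m : ℝ) ^ K * (Real.log 4 + Real.log L) +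
          ((Finset.univ.filter fun w => c.successProb H j w < 1 / 2).card : ℝ) * Real.log m := by
        rw [Finset.sum_add_distrib, ← Finset.sum_filter, Finset.sum_const, Finset.sum_const,
          Finset.card_univ, nsmul_eq_mul, nsmul_eq_mul, hcard]
      _ ≤ (m : ℝ) ^ K * (Real.log 4 + Real.log L) +
          (2 * c.errorProb H j * (m : ℝ) ^ K) * Real.log m := by
        gcongr
        exact c.card_bad_le H j
      _ = _ := by rw [hcard, hlogL]; ring

/-! ### Power constraint and maximal entropy of the quantized signal. -/

section MaxEntropy

lemma sum_pow_natAbs_le {r : ℝ} (h0 : 0 ≤ r) (h1 : r < 1) (S : Finset ℤ) :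
    ∑ k ∈ S, r ^ k.natAbs ≤ 2 / (1 - r) := by
  have a := hasSum_geometric_of_lt_one h0 h1
  have hs : HasSum (fun k : ℤ => r ^ k.natAbs) ((1 - r)⁻¹ + r * (1 - r)⁻¹) := by
    refine HasSum.of_nat_of_neg_add_one (by simpa using a) ?_
    have := a.mul_left r
    have e : (fun n : ℕ => r ^ (-((n : ℤ) + 1)).natAbs) = fun n => r * r ^ n := by
      ext n
      rw [← pow_succ']
      congr 1
    rw [e]
    exact this
  refine (sum_le_hasSum S (fun k _ => by positivity) hs).trans ?_
  have : 0 < (1 - r)⁻¹ := inv_pos.2 (by linarith)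
  rw [div_eq_mul_inv]
  nlinarith

/-- An integer vector with small second moment has small entropy. -/
lemma entropy_int_le {Ω ι : Type*} [Fintype Ω] [Fintype ι] (f : Ω → ι → ℤ)
    {s : ℝ} (hs : 1 ≤ s) :
    entropy f ≤ (∑ x, ∑ i, ((f x i : ℝ) ^ 2 / s ^ 2 + (Real.log s + (1 + Real.log 4)))) /
      Fintype.card Ω := by
  classical
  have hs0 : 0 < s := by linarith
  set r : ℝ := Real.exp (-(1 / s)) with hr
  have hr0 : 0 < r := Real.exp_pos _
  have hr1 : 1 / (2 * s) ≤ 1 - r := by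
    have h1 : 1 + 1 / s ≤ Real.exp (1 / s) := by
      have := Real.add_one_le_exp (1 / s); linarith
    have h2 : r ≤ (1 + 1 / s)⁻¹ := by
      rw [hr, Real.exp_neg]
      exact inv_anti₀ (by positivity) h1
    have h3 : (1 + 1 / s)⁻¹ = 1 - 1 / (s + 1) := by field_simp; ring
    have h4 : 1 / (2 * s) ≤ 1 / (s + 1) := one_div_le_one_div_of_le (by linarith) (by linarith)
    linarith
  have hr2 : r < 1 := by
    have : 0 < 1 / (2 * s) := by positivity
    linarith
  -- A two-sided geometric law of scale `s`, the reference law for Gibbs' inequality. Since `1 - r ≥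
  -- 1 / (2s)`, the total weight `2 / (1 - r)` is at most `4s`.
  let q : ℤ → ℝ := fun k => r ^ k.natAbs / (4 * s)
  have hq (k) : 0 < q k := by positivity
  have hqs (S : Finset ℤ) : ∑ k ∈ S, q k ≤ 1 := by
    rw [← Finset.sum_div, div_le_one (by positivity)]
    refine (sum_pow_natAbs_le hr0.le hr2 S).trans ?_
    rw [div_le_iff₀ (by linarith)]
    rw [div_le_iff₀ (by positivity)] at hr1
    nlinarith
  have hlog (k : ℤ) : -Real.log (q k) ≤ (k : ℝ) ^ 2 / s ^ 2 + (Real.log s + (1 + Real.log 4)) := by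
    simp only [q]
    rw [Real.log_div (by positivity) (by positivity), Real.log_pow, hr, Real.log_exp,
      Real.log_mul (by norm_num) hs0.ne', Nat.cast_natAbs, Int.cast_abs]
    have : |(k : ℝ)| * (1 / s) ≤ (k : ℝ) ^ 2 / s ^ 2 + 1 := by
      rw [← sq_abs (k : ℝ), ← div_pow, mul_one_div]
      nlinarith [sq_nonneg (|(k : ℝ)| / s - 1), sq_nonneg (|(k : ℝ)| / s)]
    linarith
  rw [entropy_eq_condEntropy]
  refine (condEntropy_le_of_kernel f _ (fun a _ => ∏ i, q (a i))
    (fun a _ => Finset.prod_nonneg fun i _ => (hq _).le)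
    (fun x => Finset.prod_pos fun i _ => hq _) (fun _ => ?_)).trans ?_
  · calc _ ≤ ∑ a ∈ Fintype.piFinset fun i => Finset.univ.image fun x => f x i, ∏ i, q (a i) := by
          refine Finset.sum_le_sum_of_subset_of_nonneg ?_ fun a _ _ =>
            Finset.prod_nonneg fun i _ => (hq _).le
          intro a ha
          obtain ⟨x, rfl⟩ : ∃ x, f x = a := by simpa using ha
          exact Fintype.mem_piFinset.2 fun i => Finset.mem_image_of_mem _ (Finset.mem_univ x)
      _ = ∏ i, ∑ k ∈ Finset.univ.image fun x => f x i, q k := by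
          rw [Finset.prod_univ_sum]
      _ ≤ 1 := Finset.prod_le_one (fun i _ => Finset.sum_nonneg fun k _ => (hq k).le)
          fun i _ => hqs _
  · refine div_le_div_of_nonneg_right (Finset.sum_le_sum fun x _ => ?_) (Nat.cast_nonneg _)
    rw [Real.log_prod fun i _ => (hq _).ne', ← Finset.sum_neg_distrib]
    exact Finset.sum_le_sum fun i _ => hlog _

/-- The integer parts of the real and imaginary parts of a complex vector. -/
def quant {ι : Type*} (x : ι → ℂ) : ι × Bool → ℤ :=
  fun i => if i.2 then ⌊(x i.1).re⌋ else ⌊(x i.1).im⌋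

lemma norm_sub_le_of_quant_eq {ι : Type*} {x y : ι → ℂ} (h : quant x = quant y) (i : ι) :
    ‖x i - y i‖ ≤ 2 := by
  have h1 := congrFun h (i, true)
  have h2 := congrFun h (i, false)
  simp only [quant, if_true] at h1
  simp only [quant, Bool.false_eq_true, if_false] at h2
  have a := Int.abs_sub_lt_one_of_floor_eq_floor h1
  have b := Int.abs_sub_lt_one_of_floor_eq_floor h2
  have := Complex.norm_le_abs_re_add_abs_im (x i - y i)
  simp only [Complex.sub_re, Complex.sub_im] at this
  linarith

lemma floor_sq_le (x : ℝ) : ((⌊x⌋ : ℤ) : ℝ) ^ 2 ≤ 2 * x ^ 2 + 2 := by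
  have h1 := Int.floor_le x
  have h2 := Int.lt_floor_add_one x
  nlinarith [sq_nonneg (x - ⌊x⌋), sq_nonneg (2 * x - ⌊x⌋)]

lemma sum_message_eq {K m : ℕ} (i : Fin K) (F : Fin m → ℝ) :
    ∑ w : Fin K → Fin m, F (w i) = (m : ℝ) ^ (K - 1) * ∑ k, F k := by
  rw [Fintype.sum_equiv (Equiv.funSplitAt i (Fin m)) (fun w => F (w i)) (fun p => F p.1)
    (fun w => by simp), Fintype.sum_prod_type]
  simp [Finset.mul_sum]

lemma Code.signal_apply {K M N n m : ℕ} (c : Code K M N n m) (H : Channel K M N)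
    (w : Fin K → Fin m) (j : Fin K) (t : Fin n) (b : Fin N) :
    c.signal H w j t b = ∑ i, ∑ a, H j i b a * c.enc i (w i) t a := by
  simp [Code.signal, Finset.sum_apply, Matrix.mulVec, dotProduct]

/-- The power constraint bounds the entropy of the quantized noise-free block. -/
lemma entropy_signal_le {K M N : ℕ} (H : Channel K M N) (j : Fin K) :
    ∃ C : ℝ, 0 ≤ C ∧ ∀ {n m : ℕ} [NeZero m] (c : Code K M N n m) {ρ : ℝ}, 1 ≤ ρ →
    (∀ i, c.power i ≤ ρ) →
    entropy (fun w => quant fun p : Fin n × Fin N => c.signal H w j p.1 p.2)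
      ≤ n * N * Real.log ρ + n * C := by
  obtain ⟨h, hh0, hh⟩ : ∃ h : ℝ, 0 ≤ h ∧ ∀ i b a, ‖H j i b a‖ ≤ h := by
    refine ⟨∑ i, ∑ b, ∑ a, ‖H j i b a‖, by positivity, fun i b a => ?_⟩
    calc _ ≤ ∑ a, ‖H j i b a‖ := Finset.single_le_sum (f := fun a => ‖H j i b a‖)
            (fun _ _ => norm_nonneg _) (Finset.mem_univ a)
      _ ≤ ∑ b, ∑ a, ‖H j i b a‖ := Finset.single_le_sum (f := fun b => ∑ a, ‖H j i b a‖)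
            (fun _ _ => by positivity) (Finset.mem_univ b)
      _ ≤ _ := Finset.single_le_sum (f := fun i => ∑ b, ∑ a, ‖H j i b a‖)
            (fun _ _ => by positivity) (Finset.mem_univ i)
  have hlog4 : 0 ≤ Real.log 4 := Real.log_nonneg (by norm_num)
  refine ⟨N * (2 * (1 + Real.log 4) + 4) + 2 * N * (K * M * h ^ 2 * K), by positivity, ?_⟩
  intro n m _ c ρ hρ hpow
  have hm : (0 : ℝ) < m := by exact_mod_cast Nat.pos_of_neZero m
  have hρ0 : 0 < ρ := by linarith
  -- With scale √ρ each integer costs (log ρ)/2 plus a normalized second moment; the real and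
  -- imaginary parts together cost log ρ per complex coordinate.
  refine (entropy_int_le _ (Real.one_le_sqrt.2 hρ)).trans ?_
  have hcard : (Fintype.card (Fin K → Fin m) : ℝ) = (m : ℝ) ^ K := by simp
  have hmK : (0 : ℝ) < (m : ℝ) ^ K := by positivity
  rw [hcard, div_le_iff₀ hmK, Real.sq_sqrt hρ0.le, Real.log_sqrt hρ0.le]
  have hterm (w : Fin K → Fin m) (t : Fin n) (b : Fin N) :
      ‖c.signal H w j t b‖ ^ 2 ≤ K * M * h ^ 2 * ∑ i, ∑ a, ‖c.enc i (w i) t a‖ ^ 2 := by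
    have e : ‖c.signal H w j t b‖ ≤ h * ∑ p : Fin K × Fin M, ‖c.enc p.1 (w p.1) t p.2‖ := by
      rw [Fintype.sum_prod_type, Finset.mul_sum]
      rw [Code.signal_apply]
      refine (norm_sum_le _ _).trans (Finset.sum_le_sum fun i _ => ?_)
      rw [Finset.mul_sum]
      refine (norm_sum_le _ _).trans (Finset.sum_le_sum fun a _ => ?_)
      rw [norm_mul]
      exact mul_le_mul_of_nonneg_right (hh _ _ _) (norm_nonneg _)
    have e2 : (∑ p : Fin K × Fin M, ‖c.enc p.1 (w p.1) t p.2‖) ^ 2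
        ≤ (K * M) * ∑ p : Fin K × Fin M, ‖c.enc p.1 (w p.1) t p.2‖ ^ 2 := by
      have := sq_sum_le_card_mul_sum_sq (s := (Finset.univ : Finset (Fin K × Fin M)))
        (f := fun p => ‖c.enc p.1 (w p.1) t p.2‖)
      simpa using this
    calc _ ≤ (h * ∑ p : Fin K × Fin M, ‖c.enc p.1 (w p.1) t p.2‖) ^ 2 :=
          pow_le_pow_left₀ (norm_nonneg _) e 2
      _ = h ^ 2 * (∑ p : Fin K × Fin M, ‖c.enc p.1 (w p.1) t p.2‖) ^ 2 := by ring
      _ ≤ h ^ 2 * ((K * M) * ∑ p : Fin K × Fin M, ‖c.enc p.1 (w p.1) t p.2‖ ^ 2) := by gcongr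
      _ = _ := by rw [Fintype.sum_prod_type]; ring
  have hw (w : Fin K → Fin m) : ∑ i : (Fin n × Fin N) × Bool,
      ((quant (fun p : Fin n × Fin N => c.signal H w j p.1 p.2) i : ℝ) ^ 2 / ρ +
        (Real.log ρ / 2 + (1 + Real.log 4)))
      ≤ n * N * Real.log ρ + n * (N * (2 * (1 + Real.log 4) + 4)) +
        2 * N * (K * M * h ^ 2) / ρ * ∑ t, ∑ i, ∑ a, ‖c.enc i (w i) t a‖ ^ 2 := by
    rw [Fintype.sum_prod_type, Fintype.sum_prod_type]
    have hb (t : Fin n) (b : Fin N) : ∑ z : Bool,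
        ((quant (fun p : Fin n × Fin N => c.signal H w j p.1 p.2) ((t, b), z) : ℝ) ^ 2 / ρ +
        (Real.log ρ / 2 + (1 + Real.log 4))) ≤ Real.log ρ + (2 * (1 + Real.log 4) + 4) +
          2 * (K * M * h ^ 2) / ρ * ∑ i, ∑ a, ‖c.enc i (w i) t a‖ ^ 2 := by
      rw [Fintype.sum_bool]
      simp only [quant, if_true, Bool.false_eq_true, if_false]
      have h1 := floor_sq_le (c.signal H w j t b).re
      have h2 := floor_sq_le (c.signal H w j t b).im
      have h3 := hterm w t b
      rw [← Complex.normSq_eq_norm_sq, Complex.normSq_apply] at h3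
      have h4 : ((⌊(c.signal H w j t b).re⌋ : ℝ) ^ 2 + (⌊(c.signal H w j t b).im⌋ : ℝ) ^ 2) / ρ
          ≤ (2 * (K * M * h ^ 2 * ∑ i, ∑ a, ‖c.enc i (w i) t a‖ ^ 2) + 4) / ρ := by
        refine div_le_div_of_nonneg_right ?_ hρ0.le; linarith
      have h5 : (4 : ℝ) / ρ ≤ 4 := div_le_self (by norm_num) hρ
      rw [add_div, add_div] at h4
      have h6 : 2 * (K * M * h ^ 2 * ∑ i, ∑ a, ‖c.enc i (w i) t a‖ ^ 2) / ρ =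
        2 * (K * M * h ^ 2) / ρ * ∑ i, ∑ a, ‖c.enc i (w i) t a‖ ^ 2 := by ring
      linarith
    refine (Finset.sum_le_sum fun t _ => Finset.sum_le_sum fun b _ => hb t b).trans (le_of_eq ?_)
    simp only [Finset.sum_const, Finset.card_univ, Fintype.card_fin, nsmul_eq_mul,
      Finset.sum_add_distrib, ← Finset.mul_sum]
    ring
  refine (Finset.sum_le_sum fun w _ => hw w).trans ?_
  rw [Finset.sum_add_distrib, Finset.sum_const, Finset.card_univ, nsmul_eq_mul, hcard,
    ← Finset.mul_sum]
  have hP : ∑ w : Fin K → Fin m, ∑ t, ∑ i, ∑ a, ‖c.enc i (w i) t a‖ ^ 2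
      ≤ K * n * ρ * (m : ℝ) ^ K := by
    have e : ∑ w : Fin K → Fin m, ∑ t, ∑ i, ∑ a, ‖c.enc i (w i) t a‖ ^ 2
        = ∑ i, ∑ w : Fin K → Fin m, ∑ t, ∑ a, ‖c.enc i (w i) t a‖ ^ 2 := by
      rw [Finset.sum_comm (s := (Finset.univ : Finset (Fin K)))]
      exact Finset.sum_congr rfl fun w _ => Finset.sum_comm
    rw [e]
    have e2 (i : Fin K) : ∑ w : Fin K → Fin m, ∑ t, ∑ a, ‖c.enc i (w i) t a‖ ^ 2
        ≤ n * ρ * (m : ℝ) ^ K := by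
      rw [sum_message_eq i (fun k => ∑ t, ∑ a, ‖c.enc i k t a‖ ^ 2)]
      have hK : (m : ℝ) ^ K = (m : ℝ) ^ (K - 1) * m := by
        rw [← pow_succ, Nat.sub_add_cancel (Nat.one_le_of_lt i.2)]
      rw [hK]
      have hp := hpow i
      -- For `n = 0` the power is a division by zero and carries no information, but the sum over
      -- time is empty.
      rcases Nat.eq_zero_or_pos n with rfl | hn
      · simp
      have hn' : (0 : ℝ) < n := by exact_mod_cast hn
      rw [Code.power, div_le_iff₀ (by positivity)] at hp
      calc _ ≤ (m : ℝ) ^ (K - 1) * (ρ * (m * n)) := by gcongr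
        _ = _ := by ring
    refine (Finset.sum_le_sum fun i _ => e2 i).trans (le_of_eq ?_)
    simp only [Finset.sum_const, Finset.card_univ, Fintype.card_fin, nsmul_eq_mul]
    ring
  have hP2 := mul_le_mul_of_nonneg_left hP
    (show 0 ≤ 2 * N * (K * M * h ^ 2) / ρ by positivity)
  refine (add_le_add_right hP2 _).trans (le_of_eq ?_)
  field_simp
  ring

end MaxEntropy

/-! ### The converse for a fixed channel that admits zero-forcing. -/

section Converse

lemma norm_mulVec_le {p q : ℕ} (A : Matrix (Fin p) (Fin q) ℂ) {x : Fin q → ℂ} {D : ℝ}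
    (hx : ∀ a, ‖x a‖ ≤ D) (b : Fin p) : ‖(A *ᵥ x) b‖ ≤ (∑ b, ∑ a, ‖A b a‖) * D := by
  have h1 : ‖(A *ᵥ x) b‖ ≤ ∑ a, ‖A b a‖ * D := by
    rw [Matrix.mulVec, dotProduct]
    refine (norm_sum_le _ _).trans (Finset.sum_le_sum fun a _ => ?_)
    rw [norm_mul]
    exact mul_le_mul_of_nonneg_left (hx a) (norm_nonneg _)
  rw [Finset.sum_mul]
  refine h1.trans ?_
  simp_rw [← Finset.sum_mul]
  rcases isEmpty_or_nonempty (Fin q) with h | ⟨⟨a⟩⟩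
  · simp
  · have hD : 0 ≤ D := (norm_nonneg _).trans (hx a)
    refine mul_le_mul_of_nonneg_right ?_ hD
    exact Finset.single_le_sum (f := fun b => ∑ a, ‖A b a‖) (fun _ _ => by positivity)
      (Finset.mem_univ b)

/-- The entropy of quantized values that are known up to a bounded error. -/
lemma condEntropy_quant_le (B : ℝ) : ∃ C : ℝ, 0 ≤ C ∧ ∀ {Ω ι β : Type} [Fintype Ω] [Nonempty Ω]
    [Fintype ι] (f : Ω → ι → ℂ) (F : Ω → β),
    (∀ x y, F x = F y → ∀ i, ‖f x i - f y i‖ ≤ B) →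
    condEntropy (fun x => quant (f x)) F ≤ Fintype.card ι * C := by
  classical
  -- Reals at distance at most `B` have floors differing by less than `B + 1`, so each real
  -- coordinate takes at most `2b + 1` values around the representative's.
  obtain ⟨b, hb⟩ : ∃ b : ℕ, B + 1 ≤ b := exists_nat_ge _
  refine ⟨2 * Real.log (2 * b + 1), ?_, ?_⟩
  · have : (1 : ℝ) ≤ 2 * b + 1 := by
      have : (0 : ℝ) ≤ b := Nat.cast_nonneg _
      linarith
    have := Real.log_nonneg this
    positivity
  intro Ω ι β _ _ _ f F hF
  let r : β → Ω := Function.invFun F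
  have hr (w) : F (r (F w)) = F w := Function.invFun_eq ⟨w, rfl⟩
  have hfl (x y : ℝ) (h : |x - y| ≤ B) : ⌊x⌋ ∈ Finset.Icc (⌊y⌋ - (b : ℤ)) (⌊y⌋ + b) := by
    have h' := abs_le.1 h
    rw [Finset.mem_Icc]
    constructor
    · have h2 : (⌊y⌋ : ℝ) - b < ⌊x⌋ := by
        have := Int.floor_le y
        have := Int.lt_floor_add_one x
        linarith
      have : ((⌊y⌋ - (b : ℤ) : ℤ) : ℝ) < (⌊x⌋ : ℤ) := by push_cast; exact h2
      exact (Int.cast_lt.1 this).le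
    · have h2 : (⌊x⌋ : ℝ) < ⌊y⌋ + b := by
        have := Int.floor_le x
        have := Int.lt_floor_add_one y
        linarith
      have : ((⌊x⌋ : ℤ) : ℝ) < (⌊y⌋ + (b : ℤ) : ℤ) := by push_cast; exact h2
      exact (Int.cast_lt.1 this).le
  let S : β → Finset (ι × Bool → ℤ) := fun β₀ =>
    Fintype.piFinset fun i => Finset.Icc (quant (f (r β₀)) i - (b : ℤ)) (quant (f (r β₀)) i + b)
  have hcard (β₀) : ((S β₀).card : ℝ) = (2 * (b : ℝ) + 1) ^ (Fintype.card ι * 2) := by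
    have (z : ℤ) : (z + b + 1 - (z - b)).toNat = 2 * b + 1 := by omega
    simp [S, Fintype.card_piFinset, this]
  refine (condEntropy_le_log_of_mem _ F S ((2 * (b : ℝ) + 1) ^ (Fintype.card ι * 2))
    (by positivity) (fun x => ?_) (fun β₀ => (hcard β₀).le)).trans (le_of_eq ?_)
  · refine Fintype.mem_piFinset.2 fun i => ?_
    have h := hF x (r (F x)) (hr x).symm i.1
    unfold quant
    split_ifs
    · exact hfl _ _ (by rw [← Complex.sub_re]; exact (Complex.abs_re_le_norm _).trans h)
    · exact hfl _ _ (by rw [← Complex.sub_im]; exact (Complex.abs_im_le_norm _).trans h)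
  · rw [Real.log_pow]; push_cast; ring

lemma entropy_message_le {K m : ℕ} [NeZero m] (i : Fin K) :
    entropy (fun w : Fin K → Fin m => w i) ≤ Real.log m := by
  classical
  rw [entropy_eq_condEntropy]
  exact condEntropy_le_log_of_mem _ _ (fun _ => Finset.univ) m
    (by exact_mod_cast Nat.pos_of_neZero m) (fun _ => Finset.mem_univ _) (fun _ => by simp)

/-- The chain rule for the messages of five users: some side information `g` and all messages
determine everything. -/
lemma five_log_le_chain {m : ℕ} {β : Type} (g : (Fin 5 → Fin m) → β)
    {a b c d e : Fin 5} (hall : ∀ i : Fin 5, i = a ∨ i = b ∨ i = c ∨ i = d ∨ i = e) :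
    5 * Real.log m ≤ entropy g + condEntropy (fun w => w a) g
      + condEntropy (fun w => w b) (fun w => (w a, g w))
      + condEntropy (fun w => w c) (fun w => (w b, w a, g w))
      + condEntropy (fun w => w d) (fun w => (w c, w b, w a, g w))
      + condEntropy (fun w => w e) (fun w => (w d, w c, w b, w a, g w)) := by
  have hinj : Function.Injective
      (fun w : Fin 5 → Fin m => (w e, w d, w c, w b, w a, g w)) := by
    intro w w' h
    simp only [Prod.mk.injEq] at h
    ext i
    rcases hall i with rfl | rfl | rfl | rfl | rfl <;> simp [h]
  have h := entropy_of_injective hinj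
  have hc : Real.log (Fintype.card (Fin 5 → Fin m)) = 5 * Real.log m := by simp
  rw [hc] at h
  rw [← h]
  unfold condEntropy
  linarith

/-- In the difference of two blocks, a user with equal messages cancels and a user nulled by `A`
disappears, which isolates user `i`. -/
lemma signal_manyToOne_zero_sub {n m : ℕ} (c : Code 5 2 5 n m) (H : Channel 5 2 5)
    (w w' : Fin 5 → Fin m) (t : Fin n) {p : ℕ} (A : Matrix (Fin p) (Fin 5) ℂ) {i : Fin 5}
    (h : ∀ k, k ≠ i → A * H 0 k = 0 ∨ w k = w' k) :
    A *ᵥ (c.signal (manyToOne H) w 0 t - c.signal (manyToOne H) w' 0 t)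
      = (A * H 0 i) *ᵥ (c.enc i (w i) t - c.enc i (w' i) t) := by
  have e : c.signal (manyToOne H) w 0 t - c.signal (manyToOne H) w' 0 t
      = ∑ k, H 0 k *ᵥ (c.enc k (w k) t - c.enc k (w' k) t) := by
    simp [Code.signal, manyToOne, Matrix.mulVec_sub]
  rw [e, Matrix.mulVec_sum, Finset.sum_eq_single i]
  · rw [Matrix.mulVec_mulVec]
  · intro k _ hk
    rw [Matrix.mulVec_mulVec]
    rcases h k hk with h | h
    · rw [h, Matrix.zero_mulVec]
    · rw [h, sub_self, Matrix.mulVec_zero]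
  · simp

lemma signal_manyToOne_of_ne {n m : ℕ} (c : Code 5 2 5 n m) (H : Channel 5 2 5)
    (w : Fin 5 → Fin m) {j : Fin 5} (hj : j ≠ 0) (t : Fin n) :
    c.signal (manyToOne H) w j t = H j j *ᵥ c.enc j (w j) t := by
  unfold Code.signal manyToOne
  rw [Finset.sum_eq_single j]
  · simp
  · intro i _ hi
    simp [hi, hj]
  · simp

/-- A label that pins down the input of user `j ≠ 0` up to a bounded error leaves little
uncertainty about its message. -/
lemma condEntropy_message_le_of_enc (H : Channel 5 2 5) (D : ℝ) : ∃ C : ℝ, 0 ≤ C ∧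
    ∀ {n m : ℕ} [NeZero m] {β : Type} (c : Code 5 2 5 n m) {j : Fin 5} (_ : j ≠ 0)
    (F : (Fin 5 → Fin m) → β),
    (∀ w w', F w = F w' → ∀ t a, ‖(c.enc j (w j) t - c.enc j (w' j) t) a‖ ≤ D) →
    condEntropy (fun w => w j) F
      ≤ Real.log 4 + n * C + 2 * c.errorProb (manyToOne H) j * Real.log m := by
  -- Summing the direct-link norms over all `j` makes one constant serve every user.
  obtain ⟨C, hC0, hC⟩ := condEntropy_message_le ((∑ j, ∑ b, ∑ a, ‖H j j b a‖) * D)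
  refine ⟨5 * C, by positivity, fun c j hj F hF => ?_⟩
  refine (hC c (manyToOne H) j F fun w w' h t b => ?_).trans (le_of_eq (by push_cast; ring))
  rw [signal_manyToOne_of_ne c H w hj, signal_manyToOne_of_ne c H w' hj, ← Pi.sub_apply,
    ← Matrix.mulVec_sub]
  refine (norm_mulVec_le _ (hF w w' h t) b).trans ?_
  have hD : 0 ≤ D := (norm_nonneg _).trans (hF w w' h t 0)
  exact mul_le_mul_of_nonneg_right (Finset.single_le_sum
    (f := fun j => ∑ b, ∑ a, ‖H j j b a‖) (fun _ _ => by positivity) (Finset.mem_univ j)) hD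

/-- Zero-forcing at receiver `0`: the input of user `1` seen through `V`, and the messages of users
`0`, `2` and `a`, contribute in full to the entropy of the signal at receiver `0`. -/
lemma entropy_signal_ge (H : Channel 5 2 5) {a b : Fin 5} (ha : a ≠ 0)
    (hall : ∀ i : Fin 5, i = 0 ∨ i = b ∨ i = 1 ∨ i = 2 ∨ i = a)
    (V : Matrix (Fin 1) (Fin 5) ℂ) (L L' : Matrix (Fin 2) (Fin 5) ℂ)
    (hV2 : V * H 0 2 = 0) (hVa : V * H 0 a = 0)
    (hL2 : L * H 0 2 = 1) (hLa : L * H 0 a = 0) (hL' : L' * H 0 a = 1) :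
    ∃ C : ℝ, 0 ≤ C ∧ ∀ {n m : ℕ} [NeZero m] (c : Code 5 2 5 n m) {e : ℝ},
    (∀ j, c.errorProb (manyToOne H) j ≤ e) →
    3 * Real.log m + entropy (fun w : Fin 5 → Fin m =>
        quant fun p : Fin n × Fin 1 => ((V * H 0 1) *ᵥ c.enc 1 (w 1) p.1) p.2)
      ≤ entropy (fun w => quant fun p : Fin n × Fin 5 => c.signal (manyToOne H) w 0 p.1 p.2)
        + n * C + C + 6 * e * Real.log m := by
  obtain ⟨C₀, hC₀, h₀⟩ := condEntropy_message_le 2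
  obtain ⟨C₁, hC₁, h₁⟩ := condEntropy_quant_le ((∑ i, ∑ j, ‖V i j‖) * 2)
  obtain ⟨C₂, hC₂, h₂⟩ := condEntropy_message_le_of_enc H ((∑ i, ∑ j, ‖L i j‖) * 2)
  obtain ⟨C₃, hC₃, h₃⟩ := condEntropy_message_le_of_enc H ((∑ i, ∑ j, ‖L' i j‖) * 2)
  have hlog4 : 0 ≤ Real.log 4 := Real.log_nonneg (by norm_num)
  refine ⟨3 * Real.log 4 + 5 * C₀ + C₁ + C₂ + C₃, by positivity, ?_⟩
  intro n m _ c e he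
  set T := fun w => quant fun p : Fin n × Fin 5 => c.signal (manyToOne H) w 0 p.1 p.2 with hT
  set q := fun w : Fin 5 → Fin m =>
    quant fun p : Fin n × Fin 1 => ((V * H 0 1) *ᵥ c.enc 1 (w 1) p.1) p.2 with hq
  have hm : 0 ≤ Real.log m := Real.log_nonneg (by exact_mod_cast Nat.pos_of_neZero m)
  have hTT (w w') (h : T w = T w') (t : Fin n) (k : Fin 5) :
      ‖(c.signal (manyToOne H) w 0 t - c.signal (manyToOne H) w' 0 t) k‖ ≤ 2 :=
    norm_sub_le_of_quant_eq h (t, k)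
  have hchain := five_log_le_chain T hall
  have b0 : condEntropy (fun w => w 0) T ≤ Real.log 4 + n * 5 * C₀ + 2 * e * Real.log m := by
    refine (h₀ c (manyToOne H) 0 T fun w w' h t k => hTT w w' h t k).trans ?_
    have := mul_le_mul_of_nonneg_right (he 0) hm
    push_cast
    linarith
  -- Message `b` is given away at full price `log m`: `V` does not null this user, so it must be
  -- known before user 1 can be isolated.
  have bb : condEntropy (fun w => w b) (fun w => (w 0, T w)) ≤ Real.log m :=
    (condEntropy_le_entropy _ _).trans (entropy_message_le b)
  -- With G the known data, H(w₁ | G) ≤ H(q | G) + H(w₁ | q). The first term is O(n) because `V`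
  -- recovers `q` up to a bounded error; the second is H(w₁) - H(q) because `q` is a function of w₁.
  have b1 : condEntropy (fun w => w 1) (fun w => (w b, w 0, T w))
      ≤ n * C₁ + (Real.log m - entropy q) := by
    have e1 : condEntropy q (fun w => (w b, w 0, T w)) ≤ n * C₁ := by
      refine (h₁ (fun (w : Fin 5 → Fin m) (p : Fin n × Fin 1) =>
        ((V * H 0 1) *ᵥ c.enc 1 (w 1) p.1) p.2) _ ?_).trans (le_of_eq (by simp))
      intro w w' h p
      simp only [Prod.mk.injEq] at h
      rw [← Pi.sub_apply, ← Matrix.mulVec_sub, ← signal_manyToOne_zero_sub c H w w' p.1 V]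
      · exact norm_mulVec_le V (hTT w w' h.2.2 p.1) p.2
      · intro k hk
        rcases hall k with rfl | rfl | rfl | rfl | rfl
        · exact Or.inr h.2.1
        · exact Or.inr h.1
        · exact absurd rfl hk
        · exact Or.inl hV2
        · exact Or.inl hVa
    have e2 : condEntropy (fun w => w 1) (fun w => (q w, w b, w 0, T w))
        ≤ condEntropy (fun w => w 1) q :=
      condEntropy_mono fun w w' h => (Prod.mk.inj h).1
    have e3 : entropy (fun w => (w 1, q w)) = entropy (fun w : Fin 5 → Fin m => w 1) := by
      refine entropy_congr fun w w' => ?_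
      simp only [Prod.mk.injEq, and_iff_left_iff_imp]
      intro h
      simp only [hq, h]
    have e4 := entropy_message_le (m := m) (1 : Fin 5)
    have e5 : entropy (fun w => (w 1, w b, w 0, T w))
        ≤ entropy (fun w => (w 1, q w, w b, w 0, T w)) :=
      entropy_le_of_imp fun w w' h => by simp only [Prod.mk.injEq] at h ⊢; tauto
    unfold condEntropy at e1 e2 ⊢
    linarith
  have b2 : condEntropy (fun w => w 2) (fun w => (w 1, w b, w 0, T w))
      ≤ Real.log 4 + n * C₂ + 2 * e * Real.log m := by
    refine (h₂ c (by decide) _ fun w w' h t k => ?_).trans ?_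
    · simp only [Prod.mk.injEq] at h
      rw [← Matrix.one_mulVec (c.enc 2 (w 2) t - c.enc 2 (w' 2) t), ← hL2,
        ← signal_manyToOne_zero_sub c H w w' t L]
      · exact norm_mulVec_le L (hTT w w' h.2.2.2 t) k
      · intro k hk
        rcases hall k with rfl | rfl | rfl | rfl | rfl
        · exact Or.inr h.2.2.1
        · exact Or.inr h.2.1
        · exact Or.inr h.1
        · exact absurd rfl hk
        · exact Or.inl hLa
    · have := mul_le_mul_of_nonneg_right (he 2) hm
      linarith
  have ba : condEntropy (fun w => w a) (fun w => (w 2, w 1, w b, w 0, T w))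
      ≤ Real.log 4 + n * C₃ + 2 * e * Real.log m := by
    refine (h₃ c ha _ fun w w' h t k => ?_).trans ?_
    · simp only [Prod.mk.injEq] at h
      rw [← Matrix.one_mulVec (c.enc a (w a) t - c.enc a (w' a) t), ← hL',
        ← signal_manyToOne_zero_sub c H w w' t L']
      · exact norm_mulVec_le L' (hTT w w' h.2.2.2.2 t) k
      · intro k hk
        rcases hall k with rfl | rfl | rfl | rfl | rfl
        · exact Or.inr h.2.2.2.1
        · exact Or.inr h.2.2.1
        · exact Or.inr h.2.1
        · exact Or.inr h.1
        · exact absurd rfl hk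
    · have := mul_le_mul_of_nonneg_right (he a) hm
      linarith
  have hn : (0 : ℝ) ≤ n * Real.log 4 := by positivity
  linarith

/-- The linear algebra behind the converse: receiver `0` can zero-force users `2` and `3`, or users
`2` and `4`, seeing two independent functionals of the input of user `1`, and can resolve both
pairs of users. -/
structure ZeroForcing (H : Channel 5 2 5) (V V' : Matrix (Fin 1) (Fin 5) ℂ)
    (L L₁ L' L₁' : Matrix (Fin 2) (Fin 5) ℂ) (B B' : Matrix (Fin 2) (Fin 1) ℂ) : Prop where
  V_two : V * H 0 2 = 0
  V_three : V * H 0 3 = 0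
  V'_two : V' * H 0 2 = 0
  V'_four : V' * H 0 4 = 0
  L_two : L * H 0 2 = 1
  L_three : L * H 0 3 = 0
  L₁_three : L₁ * H 0 3 = 1
  L'_two : L' * H 0 2 = 1
  L'_four : L' * H 0 4 = 0
  L₁'_four : L₁' * H 0 4 = 1
  B_mul : B * (V * H 0 1) + B' * (V' * H 0 1) = 1

/-- The converse for a fixed code, when receiver `0` can zero-force. -/
lemma ZeroForcing.seven_log_le {H : Channel 5 2 5} {V V' : Matrix (Fin 1) (Fin 5) ℂ}
    {L L₁ L' L₁' : Matrix (Fin 2) (Fin 5) ℂ} {B B' : Matrix (Fin 2) (Fin 1) ℂ}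
    (h : ZeroForcing H V V' L L₁ L' L₁' B B') :
    ∃ C : ℝ, 0 ≤ C ∧ ∀ {n m : ℕ} [NeZero m] (c : Code 5 2 5 n m) {ρ e : ℝ}, 1 ≤ ρ →
    (∀ i, c.power i ≤ ρ) → (∀ j, c.errorProb (manyToOne H) j ≤ e) →
    7 * Real.log m ≤ 10 * n * Real.log ρ + n * C + C + 14 * e * Real.log m := by
  obtain ⟨C₀, hC₀, h₀⟩ := entropy_signal_le (manyToOne H) 0
  obtain ⟨C₁, hC₁, h₁⟩ := entropy_signal_ge H (a := 3) (b := 4) (by decide) (by decide) V L L₁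
    h.V_two h.V_three h.L_two h.L_three h.L₁_three
  obtain ⟨C₂, hC₂, h₂⟩ := entropy_signal_ge H (a := 4) (b := 3) (by decide) (by decide) V' L' L₁'
    h.V'_two h.V'_four h.L'_two h.L'_four h.L₁'_four
  obtain ⟨C₃, hC₃, h₃⟩ := condEntropy_message_le_of_enc H
    ((∑ i, ∑ j, ‖B i j‖) * 2 + (∑ i, ∑ j, ‖B' i j‖) * 2)
  have hlog4 : 0 ≤ Real.log 4 := Real.log_nonneg (by norm_num)
  refine ⟨2 * C₀ + C₁ + C₂ + C₃ + Real.log 4, by positivity, ?_⟩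
  intro n m _ c ρ e hρ hpow he
  have hm : 0 ≤ Real.log m := Real.log_nonneg (by exact_mod_cast Nat.pos_of_neZero m)
  have g₀ := h₀ c hρ hpow
  have g₁ := h₁ c he
  have g₂ := h₂ c he
  set q := fun w : Fin 5 → Fin m =>
    quant fun p : Fin n × Fin 1 => ((V * H 0 1) *ᵥ c.enc 1 (w 1) p.1) p.2 with hq
  set q' := fun w : Fin 5 → Fin m =>
    quant fun p : Fin n × Fin 1 => ((V' * H 0 1) *ᵥ c.enc 1 (w 1) p.1) p.2 with hq'
  have hpair : entropy (fun w => (q w, q' w)) ≤ entropy q + entropy q' := by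
    have := condEntropy_le_entropy q q'
    unfold condEntropy at this
    linarith
  have g₃ : condEntropy (fun w => w 1) (fun w => (q w, q' w))
      ≤ Real.log 4 + n * C₃ + 2 * e * Real.log m := by
    refine (h₃ c (by decide) _ fun w w' hw t k => ?_).trans ?_
    · simp only [Prod.mk.injEq] at hw
      rw [← Matrix.one_mulVec (c.enc 1 (w 1) t - c.enc 1 (w' 1) t), ← h.B_mul,
        Matrix.add_mulVec, ← Matrix.mulVec_mulVec _ B, ← Matrix.mulVec_mulVec _ B', Pi.add_apply]
      refine (norm_add_le _ _).trans (add_le_add ?_ ?_)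
      · refine norm_mulVec_le B (fun a => ?_) k
        rw [Matrix.mulVec_sub]
        exact norm_sub_le_of_quant_eq hw.1 (t, a)
      · refine norm_mulVec_le B' (fun a => ?_) k
        rw [Matrix.mulVec_sub]
        exact norm_sub_le_of_quant_eq hw.2 (t, a)
    · have := mul_le_mul_of_nonneg_right (he 1) hm
      linarith
  -- Bounding the other four messages by `log m` each leaves H(q, q') ≥ log m up to the loss in
  -- `g₃`.
  have hchain := five_log_le_chain (m := m) (fun w => (q w, q' w)) (a := 1) (b := 0) (c := 2)
    (d := 3) (e := 4) (by decide)
  have k0 := (condEntropy_le_entropy (fun w : Fin 5 → Fin m => w 0)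
    (fun w => (w 1, q w, q' w))).trans (entropy_message_le 0)
  have k2 := (condEntropy_le_entropy (fun w : Fin 5 → Fin m => w 2)
    (fun w => (w 0, w 1, q w, q' w))).trans (entropy_message_le 2)
  have k3 := (condEntropy_le_entropy (fun w : Fin 5 → Fin m => w 3)
    (fun w => (w 2, w 0, w 1, q w, q' w))).trans (entropy_message_le 3)
  have k4 := (condEntropy_le_entropy (fun w : Fin 5 → Fin m => w 4)
    (fun w => (w 3, w 2, w 0, w 1, q w, q' w))).trans (entropy_message_le 4)
  have hn : (0 : ℝ) ≤ n * Real.log 4 := by positivity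
  push_cast at g₀
  linarith

end Converse

/-! ### Almost every channel admits zero-forcing. -/

section Generic

/-- The zero set of a nonzero polynomial is null for every product of atomless laws. -/
lemma pi_eval_eq_zero_null_fin {n : ℕ} (μ : Fin n → Measure ℂ) [∀ i, IsProbabilityMeasure (μ i)]
    [∀ i, NullSingletonClass (μ i)] (p : MvPolynomial (Fin n) ℂ) (hp : p ≠ 0) :
    Measure.pi μ {x | MvPolynomial.eval x p = 0} = 0 := by
  induction n with
  | zero =>
    have : {x : Fin 0 → ℂ | MvPolynomial.eval x p = 0} = ∅ := by
      ext x
      rw [MvPolynomial.eq_C_of_isEmpty p] at hp ⊢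
      simpa using hp
    rw [this, measure_empty]
  | succ n ih =>
    set q := MvPolynomial.finSuccEquiv ℂ n p with hq
    have hq0 : q ≠ 0 := by simpa [hq] using hp
    have hmp := (measurePreserving_piFinSuccAbove μ 0).symm
    have hmeas : MeasurableSet {x : Fin (n + 1) → ℂ | MvPolynomial.eval x p = 0} :=
      (MvPolynomial.continuous_eval p).measurable (measurableSet_singleton 0)
    rw [← hmp.measure_preimage hmeas.nullMeasurableSet]
    have hmeas2 := hmp.measurable hmeas
    rw [← Measure.prod_swap, Measure.map_apply measurable_swap hmeas2,
      Measure.measure_prod_null (measurable_swap hmeas2)]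
    -- View `p` as a polynomial in the first variable. Where its leading coefficient is nonzero, the
    -- slice has finitely many roots, a null set for an atomless law; Fubini concludes.
    have hae : ∀ᵐ s ∂(Measure.pi fun j => μ (Fin.succAbove 0 j)),
        MvPolynomial.eval s q.leadingCoeff ≠ 0 := by
      have := ih (fun j => μ (Fin.succAbove 0 j)) q.leadingCoeff (by simpa using hq0)
      exact measure_eq_zero_iff_ae_notMem.1 this
    filter_upwards [hae] with s hs
    have hq1 : Polynomial.map (MvPolynomial.eval s) q ≠ 0 := fun h => hs <| by
      rw [Polynomial.leadingCoeff, ← Polynomial.coeff_map, h, Polynomial.coeff_zero]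
    refine ((Polynomial.finite_setOfPred_isRoot hq1).subset fun y hy => ?_).measure_zero _
    change MvPolynomial.eval (Fin.insertNth 0 y s) p = 0 at hy
    rw [Fin.insertNth_zero', MvPolynomial.eval_eq_eval_mv_eval'] at hy
    exact hy

lemma pi_eval_eq_zero_null {σ : Type*} [Fintype σ] (μ : σ → Measure ℂ)
    [∀ i, IsProbabilityMeasure (μ i)] [∀ i, NullSingletonClass (μ i)] (p : MvPolynomial σ ℂ) (hp : p ≠ 0) :
    Measure.pi μ {x | MvPolynomial.eval x p = 0} = 0 := by
  let e := (Fintype.equivFin σ).symm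
  have h := pi_eval_eq_zero_null_fin (fun i => μ (e i)) (MvPolynomial.rename e.symm p)
    (by simpa using (MvPolynomial.rename_injective e.symm e.symm.injective).ne hp)
  have hmp := measurePreserving_piCongrLeft (fun i => μ i) e
  have hmeas : MeasurableSet {x : σ → ℂ | MvPolynomial.eval x p = 0} :=
    (MvPolynomial.continuous_eval p).measurable (measurableSet_singleton 0)
  rw [← hmp.measure_preimage hmeas.nullMeasurableSet, ← h]
  congr 1
  ext x
  have hx : MeasurableEquiv.piCongrLeft (fun _ => ℂ) e x = x ∘ e.symm := by
    ext i
    obtain ⟨k, rfl⟩ := e.surjective i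
    rw [MeasurableEquiv.coe_piCongrLeft, Equiv.piCongrLeft_apply_apply]
    simp
  rw [Set.mem_preimage, hx]
  simp only [Set.mem_ofPred_eq, MvPolynomial.eval_rename]

/-- A column followed by two blocks of two columns. -/
def bordered {R : Type*} (x : Fin 5 → R) (A A' : Matrix (Fin 5) (Fin 2) R) :
    Matrix (Fin 5) (Fin 5) R :=
  Matrix.of fun k => ![x k, A k 0, A k 1, A' k 0, A' k 1]

lemma bordered_updateCol {R : Type*} (x y : Fin 5 → R) (A A' : Matrix (Fin 5) (Fin 2) R) :
    (bordered x A A').updateCol 0 y = bordered y A A' := by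
  ext k l
  fin_cases l <;> simp [bordered]

/-- The determinant whose nonvanishing makes zero-forcing possible. -/
def zeroForcingDet {R : Type*} [CommRing R] (G : Fin 5 → Matrix (Fin 5) (Fin 2) R) : R :=
  (bordered (fun k => G 1 k 0) (G 2) (G 3)).det * (bordered (fun k => G 1 k 1) (G 2) (G 4)).det -
  (bordered (fun k => G 1 k 1) (G 2) (G 3)).det * (bordered (fun k => G 1 k 0) (G 2) (G 4)).det

lemma map_bordered_det {R S : Type*} [CommRing R] [CommRing S] (f : R →+* S)
    (x : Fin 5 → R) (A A' : Matrix (Fin 5) (Fin 2) R) :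
    f (bordered x A A').det = (bordered (fun k => f (x k)) (A.map f) (A'.map f)).det := by
  rw [RingHom.map_det]
  congr 1
  ext k l
  fin_cases l <;> simp [bordered]

lemma map_zeroForcingDet {R S : Type*} [CommRing R] [CommRing S] (f : R →+* S)
    (G : Fin 5 → Matrix (Fin 5) (Fin 2) R) :
    f (zeroForcingDet G) = zeroForcingDet fun i => (G i).map f := by
  simp only [zeroForcingDet, map_sub, map_mul, map_bordered_det, Matrix.map_apply]

/-- A row orthogonal to two blocks of two columns. -/
lemma exists_zeroForcing_row (A A' : Matrix (Fin 5) (Fin 2) ℂ) :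
    ∃ V : Matrix (Fin 1) (Fin 5) ℂ, V * A = 0 ∧ V * A' = 0 ∧
      ∀ G : Matrix (Fin 5) (Fin 2) ℂ, ∀ i b, (V * G) i b = (bordered (fun k => G k b) A A').det := by
  let V : Matrix (Fin 1) (Fin 5) ℂ := Matrix.of fun _ k =>
    (bordered 0 A A').cramer (Pi.single k 1) 0
  have h (G : Matrix (Fin 5) (Fin 2) ℂ) (i b) :
      (V * G) i b = (bordered (fun k => G k b) A A').det := by
    rw [← bordered_updateCol 0, ← Matrix.cramer_apply]
    have := congrFun (LinearMap.pi_apply_eq_sum_univ (bordered 0 A A').cramer fun k => G k b) 0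
    rw [this, Matrix.mul_apply, Finset.sum_apply]
    refine Finset.sum_congr rfl fun k _ => ?_
    have e : (Pi.single k 1 : Fin 5 → ℂ) = fun j => if k = j then 1 else 0 := by
      ext j; simp [Pi.single_apply, eq_comm]
    simp [V, e, mul_comm]
  refine ⟨V, ?_, ?_, h⟩
  · ext i b
    rw [h]
    fin_cases b
    · exact Matrix.det_zero_of_column_eq (i := 0) (j := 1) (by decide) fun k => by simp [bordered]
    · exact Matrix.det_zero_of_column_eq (i := 0) (j := 2) (by decide) fun k => by simp [bordered]
  · ext i b
    rw [h]
    fin_cases b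
    · exact Matrix.det_zero_of_column_eq (i := 0) (j := 3) (by decide) fun k => by simp [bordered]
    · exact Matrix.det_zero_of_column_eq (i := 0) (j := 4) (by decide) fun k => by simp [bordered]

/-- The required matrices are the rows of the inverse of `bordered x A A'` belonging to the two
blocks. -/
lemma exists_resolving_of_det_ne_zero {x : Fin 5 → ℂ} {A A' : Matrix (Fin 5) (Fin 2) ℂ}
    (h : (bordered x A A').det ≠ 0) :
    ∃ L L' : Matrix (Fin 2) (Fin 5) ℂ, L * A = 1 ∧ L * A' = 0 ∧ L' * A' = 1 := by
  set M := bordered x A A' with hM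
  have hinv : M⁻¹ * M = 1 := Matrix.nonsing_inv_mul _ (isUnit_iff_ne_zero.2 h)
  have hA : A = M.submatrix id ![1, 2] := by
    ext k b; fin_cases b <;> simp [hM, bordered]
  have hA' : A' = M.submatrix id ![3, 4] := by
    ext k b; fin_cases b <;> simp [hM, bordered]
  have key (r s : Fin 2 → Fin 5) :
      M⁻¹.submatrix r id * M.submatrix id s = (1 : Matrix (Fin 5) (Fin 5) ℂ).submatrix r s := by
    rw [← hinv, Matrix.submatrix_mul _ _ r id s Function.bijective_id]
  refine ⟨M⁻¹.submatrix ![1, 2] id, M⁻¹.submatrix ![3, 4] id, ?_, ?_, ?_⟩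
  · rw [hA, key]; ext i j; fin_cases i <;> fin_cases j <;> simp [Matrix.one_apply]
  · rw [hA', key]; ext i j; fin_cases i <;> fin_cases j <;> simp [Matrix.one_apply]
  · rw [hA', key]; ext i j; fin_cases i <;> fin_cases j <;> simp [Matrix.one_apply]

/-- `zeroForcingDet` is the determinant of the 2×2 matrix with rows `V * H 0 1` and `V' * H 0 1`,
whose inverse supplies `B` and `B'`. For each pair of nulled users it also forces some bordered
determinant to be nonzero, since otherwise both of its products vanish. -/
lemma exists_zeroForcing {H : Channel 5 2 5} (h : zeroForcingDet (H 0) ≠ 0) :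
    ∃ V V' L L₁ L' L₁' B B', ZeroForcing H V V' L L₁ L' L₁' B B' := by
  obtain ⟨V, hV2, hV3, hV⟩ := exists_zeroForcing_row (H 0 2) (H 0 3)
  obtain ⟨V', hV2', hV4', hV'⟩ := exists_zeroForcing_row (H 0 2) (H 0 4)
  have hL : ∃ L L' : Matrix (Fin 2) (Fin 5) ℂ, L * H 0 2 = 1 ∧ L * H 0 3 = 0 ∧ L' * H 0 3 = 1 := by
    by_cases h1 : (bordered (fun k => H 0 1 k 0) (H 0 2) (H 0 3)).det = 0
    · by_cases h2 : (bordered (fun k => H 0 1 k 1) (H 0 2) (H 0 3)).det = 0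
      · exact absurd (by simp [zeroForcingDet, h1, h2]) h
      · exact exists_resolving_of_det_ne_zero h2
    · exact exists_resolving_of_det_ne_zero h1
  have hL' : ∃ L L' : Matrix (Fin 2) (Fin 5) ℂ, L * H 0 2 = 1 ∧ L * H 0 4 = 0 ∧ L' * H 0 4 = 1 := by
    by_cases h1 : (bordered (fun k => H 0 1 k 0) (H 0 2) (H 0 4)).det = 0
    · by_cases h2 : (bordered (fun k => H 0 1 k 1) (H 0 2) (H 0 4)).det = 0
      · exact absurd (by simp [zeroForcingDet, h1, h2]) h
      · exact exists_resolving_of_det_ne_zero h2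
    · exact exists_resolving_of_det_ne_zero h1
  obtain ⟨L, L₁, hL⟩ := hL
  obtain ⟨L', L₁', hL'⟩ := hL'
  let U : Matrix (Fin 2) (Fin 2) ℂ := !![(V * H 0 1) 0 0, (V * H 0 1) 0 1;
    (V' * H 0 1) 0 0, (V' * H 0 1) 0 1]
  have hU : U.det ≠ 0 := by
    simp only [U, Matrix.det_fin_two_of, hV, hV']
    exact h
  have hinv : U⁻¹ * U = 1 := Matrix.nonsing_inv_mul _ (isUnit_iff_ne_zero.2 hU)
  refine ⟨V, V', L, L₁, L', L₁', Matrix.of fun i _ => U⁻¹ i 0, Matrix.of fun i _ => U⁻¹ i 1,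
    hV2, hV3, hV2', hV4', hL.1, hL.2.1, hL.2.2, hL'.1, hL'.2.1, hL'.2.2, ?_⟩
  rw [← hinv]
  ext i j
  rw [Matrix.add_apply, Matrix.mul_apply, Matrix.mul_apply (M := Matrix.of fun i _ => U⁻¹ i 1),
    Matrix.mul_apply (M := U⁻¹)]
  simp only [Finset.univ_unique, Finset.sum_singleton, Fin.sum_univ_two, Matrix.of_apply]
  fin_cases j <;> simp [U]

/-- Zero-forcing is possible for almost every channel with independent atomless entries. -/
lemma ae_zeroForcingDet_ne_zero {Ω : Type*} [MeasurableSpace Ω] (P : Measure Ω)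
    [IsProbabilityMeasure P] (H : Ω → Channel 5 2 5)
    (hmeas : ∀ j i a b, Measurable fun ω => H ω j i a b)
    (hindep : iIndepFun
      (fun (e : Fin 5 × Fin 5 × Fin 5 × Fin 2) ω => H ω e.1 e.2.1 e.2.2.1 e.2.2.2) P)
    (hcont : ∀ j i a b, ∀ x : ℂ, P {ω | H ω j i a b = x} = 0) :
    ∀ᵐ ω ∂P, zeroForcingDet (H ω 0) ≠ 0 := by
  let X : Fin 5 → Matrix (Fin 5) (Fin 2) (MvPolynomial (Fin 5 × Fin 5 × Fin 5 × Fin 2) ℂ) :=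
    fun i => Matrix.of fun a b => MvPolynomial.X (0, i, a, b)
  have heval (x : Fin 5 × Fin 5 × Fin 5 × Fin 2 → ℂ) :
      MvPolynomial.eval x (zeroForcingDet X) =
        zeroForcingDet fun i => Matrix.of fun a b => x (0, i, a, b) := by
    rw [map_zeroForcingDet]
    congr 1
    ext i a b
    simp [X]
  have hne : zeroForcingDet X ≠ 0 := by
    intro h0
    -- Each column is a standard basis vector, indexed by `g`. The first product consists of two
    -- permutation determinants; the second vanishes because a basis vector is repeated.
    let g : Fin 5 → Fin 2 → Fin 5 := ![![0, 0], ![4, 3], ![0, 1], ![2, 3], ![2, 4]]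
    have h1 := heval fun e => if e.2.2.1 = g e.2.1 e.2.2.2 then 1 else 0
    rw [h0, map_zero] at h1
    revert h1
    simp [zeroForcingDet, bordered, g, Matrix.det_succ_row_zero, Fin.sum_univ_succ,
      show Fin.succAbove (1 : Fin 4) (2 : Fin 3) = 3 from rfl,
      show Fin.succAbove (1 : Fin 5) (2 : Fin 4) = 3 from rfl,
      show Fin.succAbove (1 : Fin 5) (3 : Fin 4) = 4 from rfl]
  have hmap := hindep.map_fun_eq_pi_map fun e => (hmeas _ _ _ _).aemeasurable
  have hprob (e : Fin 5 × Fin 5 × Fin 5 × Fin 2) : IsProbabilityMeasure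
      (P.map fun ω => H ω e.1 e.2.1 e.2.2.1 e.2.2.2) :=
    Measure.isProbabilityMeasure_map (hmeas _ _ _ _).aemeasurable
  have hatom (e : Fin 5 × Fin 5 × Fin 5 × Fin 2) : NullSingletonClass
      (P.map fun ω => H ω e.1 e.2.1 e.2.2.1 e.2.2.2) :=
    ⟨fun x => by
      rw [Measure.map_apply (hmeas _ _ _ _) (measurableSet_singleton x)]
      exact hcont _ _ _ _ x⟩
  have hnull := pi_eval_eq_zero_null
    (fun e : Fin 5 × Fin 5 × Fin 5 × Fin 2 => P.map fun ω => H ω e.1 e.2.1 e.2.2.1 e.2.2.2) _ hne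
  have hset : MeasurableSet {x | MvPolynomial.eval x (zeroForcingDet X) = 0} :=
    (MvPolynomial.continuous_eval _).measurable (measurableSet_singleton 0)
  have hpi : Measurable fun ω (e : Fin 5 × Fin 5 × Fin 5 × Fin 2) =>
      H ω e.1 e.2.1 e.2.2.1 e.2.2.2 := measurable_pi_lambda _ fun e => hmeas _ _ _ _
  rw [← hmap, Measure.map_apply hpi hset] at hnull
  filter_upwards [measure_eq_zero_iff_ae_notMem.1 hnull] with ω hω h
  refine hω ?_
  simp only [Set.mem_preimage, Set.mem_ofPred_eq, heval]
  exact h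

end Generic

/-! ### From block codes to degrees of freedom. -/

section DoF

/-- When receiver `0` can zero-force, every achievable rate is at most `(10 / 7) log ρ` up to a
constant. -/
lemma ZeroForcing.rate_le {H : Channel 5 2 5} {V V' : Matrix (Fin 1) (Fin 5) ℂ}
    {L L₁ L' L₁' : Matrix (Fin 2) (Fin 5) ℂ} {B B' : Matrix (Fin 2) (Fin 1) ℂ}
    (h : ZeroForcing H V V' L L₁ L' L₁' B B') :
    ∃ C : ℝ, ∀ {ρ : ℝ} {R : ℝ≥0}, 1 ≤ ρ → IsAchievable (manyToOne H) ρ R →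
    (R : ℝ) ≤ 10 / 7 * Real.log ρ + C := by
  obtain ⟨C, hC0, hC⟩ := h.seven_log_le
  refine ⟨2 * C / 7, fun {ρ R} hρ hR => ?_⟩
  -- For fixed `e` a single block length `n ≥ 1` suffices: then `n * C + C ≤ 2 * n * C`, and `n`
  -- cancels. The bound `e < 1 / 2` keeps `7 - 14 * e` positive; afterwards `e` tends to 0.
  have key : ∀ e : ℝ, 0 < e → e < 1 / 2 → (7 - 14 * e) * R ≤ 10 * Real.log ρ + 2 * C := by
    intro e he he'
    obtain ⟨n, ⟨c, hpow, herr⟩, hn⟩ := ((hR e he).and (eventually_ge_atTop 1)).exists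
    have : NeZero ⌈Real.exp (n * R)⌉₊ := ⟨(Nat.ceil_pos.2 (Real.exp_pos _)).ne'⟩
    have h1 := hC c hρ hpow herr
    have h2 : (n * R : ℝ) ≤ Real.log ⌈Real.exp (n * R)⌉₊ := by
      rw [Real.le_log_iff_exp_le (by exact_mod_cast Nat.ceil_pos.2 (Real.exp_pos _))]
      exact Nat.le_ceil _
    have hn' : (1 : ℝ) ≤ n := by exact_mod_cast hn
    have h3 : (7 - 14 * e) * (n * R) ≤ n * (10 * Real.log ρ + 2 * C) := by
      have a := mul_le_mul_of_nonneg_left h2 (show 0 ≤ 7 - 14 * e by linarith)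
      have b : C ≤ n * C := le_mul_of_one_le_left hC0 hn'
      linarith
    have h4 : (n : ℝ) * ((7 - 14 * e) * R) ≤ n * (10 * Real.log ρ + 2 * C) := by linarith
    exact le_of_mul_le_mul_left h4 (by linarith)
  have hlim : Tendsto (fun e : ℝ => (7 - 14 * e) * R) (𝓝[>] 0) (𝓝 ((7 - 14 * 0) * R)) := by
    refine Tendsto.mono_left (Continuous.tendsto ?_ 0) nhdsWithin_le_nhds
    fun_prop
  have h7 := le_of_tendsto hlim (b := 10 * Real.log ρ + 2 * C) (by
    filter_upwards [Ioo_mem_nhdsGT (show (0 : ℝ) < 1 / 2 by norm_num)] with e he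
    exact key e he.1 he.2)
  linarith

lemma decompositionBound_two_five : decompositionBound 2 5 = 10 / 7 := by
  unfold decompositionBound
  norm_num

/-- The additive constant vanishes on division by log ρ, which tends to infinity. -/
lemma upperDoF_le_of_rate_le {K M N : ℕ} {H : Channel K M N} {a C : ℝ}
    (h : ∀ {ρ : ℝ} {R : ℝ≥0}, 1 ≤ ρ → IsAchievable H ρ R → (R : ℝ) ≤ a * Real.log ρ + C) :
    upperDoF H ≤ ENNReal.ofReal a := by
  have hlim : Tendsto (fun ρ : ℝ => ENNReal.ofReal (a + C / Real.log ρ)) atTop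
      (𝓝 (ENNReal.ofReal a)) := by
    refine ENNReal.tendsto_ofReal ?_
    simpa using (tendsto_const_nhds (x := a)).add (Real.tendsto_log_atTop.const_div_atTop C)
  rw [upperDoF, ← hlim.limsup_eq]
  refine limsup_le_limsup ?_
  filter_upwards [eventually_gt_atTop 1] with ρ hρ
  have hlog : 0 < Real.log ρ := Real.log_pos hρ
  have hcap : symmetricCapacity H ρ ≤ ENNReal.ofReal (a * Real.log ρ + C) := by
    refine iSup₂_le fun R hR => ?_
    rw [← ENNReal.ofReal_coe_nnreal]
    exact ENNReal.ofReal_le_ofReal (h hρ.le hR)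
  refine (ENNReal.div_le_div_right hcap _).trans (le_of_eq ?_)
  rw [← ENNReal.ofReal_div_of_pos hlog]
  congr 1
  field_simp

end DoF

end MIMO

end

theorem mainTheorem9 {Ω : Type*} [MeasurableSpace Ω] (P : Measure Ω) [IsProbabilityMeasure P]
    (H : Ω → MIMO.Channel 5 2 5)
    (hmeas : ∀ j i a b, Measurable fun ω => H ω j i a b)
    (hindep : iIndepFun
      (fun (e : Fin 5 × Fin 5 × Fin 5 × Fin 2) ω => H ω e.1 e.2.1 e.2.2.1 e.2.2.2) P)
    (hcont : ∀ j i a b, ∀ x : ℂ, P {ω | H ω j i a b = x} = 0) :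
    MIMO.decompositionBound 2 5 = 10 / 7 ∧
    ∀ᵐ ω ∂P,
      MIMO.upperDoF (MIMO.manyToOne (H ω)) ≤ MIMO.decompositionBound 2 5 ∧
      ∀ d, MIMO.HasDoF (MIMO.manyToOne (H ω)) d → d ≤ MIMO.decompositionBound 2 5 := by
  refine ⟨MIMO.decompositionBound_two_five, ?_⟩
  filter_upwards [MIMO.ae_zeroForcingDet_ne_zero P H hmeas hindep hcont] with ω hω
  obtain ⟨V, V', L, L₁, L', L₁', B, B', hzf⟩ := MIMO.exists_zeroForcing hω
  obtain ⟨C, hC⟩ := hzf.rate_le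
  have hle : MIMO.upperDoF (MIMO.manyToOne (H ω)) ≤ MIMO.decompositionBound 2 5 := by
    refine (MIMO.upperDoF_le_of_rate_le hC).trans (le_of_eq ?_)
    rw [MIMO.decompositionBound_two_five, ENNReal.ofReal_div_of_pos (by norm_num)]
    norm_num
  exact ⟨hle, fun d hd => hd.limsup_eq ▸ hle⟩
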